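/- Let $\lambda>0$, $\mu>1$, $c>0$, $m\in(-1,1)$. Let $N$ be a homogeneous Poisson process with rate $\mu$ on a probability space $(\Omega,\mathcal H,\mathbb P_0)$, with jump times $0=\sigma_0<\sigma_1<\sigma_2<\cdots$, let $\mathbb F$ be the right-continuous enlargement with $\mathbb P_0$-null events of the natural filtration of $N$, and let $\mathcal S$ be the set of $[0,\infty]$-valued $\mathbb F$-stopping times. For $\phi=(\phi_0,\phi_1)\in\mathbb R_+^2$ let $\tilde\Phi=(\tilde\Phi^{(0)},\tilde\Phi^{(1)})$ be the process with $\tilde\Phi_0=\phi$ and $$d\tilde\Phi^{(0)}_t=\Big[(\lambda+1)\tilde\Phi^{(0)}_t+\tfrac{\lambda(1-m)}{\sqrt2}\Big]dt-\tfrac1\mu\tilde\Phi^{(0)}_{t-}dN_t,\qquad d\tilde\Phi^{(1)}_t=\Big[(\lambda-1)\tilde\Phi^{(1)}_t+\tfrac{\lambda(1+m)}{\sqrt2}\Big]dt+\tfrac1\mu\tilde\Phi^{(1)}_{t-}dN_t,$$ and write $\mathbb E_0^{\phi}$ for the expectation under $\mathbb P_0$ when $\tilde\Phi$ starts from $\phi$.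 Put $g(\phi_0,\phi_1)=\phi_0+\phi_1-\frac{\lambda}{c}\sqrt2$ and, for $n\in\mathbb N=\{1,2,\dots\}$, $$V_n(\phi)=\inf_{\tau\in\mathcal S}\mathbb E_0^{\phi}\Big[\int_0^{\tau\wedge\sigma_n}e^{-\lambda t}g(\tilde\Phi_t)\,dt\Big].$$ For a bounded Borel function $w:\mathbb R_+^2\to\mathbb R$ and $t\in[0,\infty]$ let $$Jw(t,\phi)=\mathbb E_0^{\phi}\Big[\int_0^{t\wedge\sigma_1}e^{-\lambda u}g(\tilde\Phi_u)\,du+\mathbf 1_{\{t\ge\sigma_1\}}e^{-\lambda\sigma_1}w(\tilde\Phi_{\sigma_1})\Big],\qquad J_0w(\phi)=\inf_{t\in[0,\infty]}Jw(t,\phi),$$ and let $v_0\equiv0$, $v_n=J_0v_{n-1}$ for $n\ge1$. For $\varepsilon\ge0$ and $n\ge0$ let $$r_n^\varepsilon(\phi)=\inf\{s\in(0,\infty]:Jv_n(s,\phi)\le J_0v_n(\phi)+\varepsilon\},$$ where $r_n^\varepsilon(\phi)=0$ if this set is empty (which can happen only if $\varepsilon=0$ and the infimum $J_0v_n(\phi)=0$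 is attained only at $t=0$). Let $S_1^\varepsilon=r_0^\varepsilon(\tilde\Phi_0)\wedge\sigma_1$ and, for $n\ge 0$, $$S_{n+2}^\varepsilon=\begin{cases}r_{n+1}^{\varepsilon/2}(\tilde\Phi_0),&\sigma_1>r_{n+1}^{\varepsilon/2}(\tilde\Phi_0),\\ \sigma_1+S_{n+1}^{\varepsilon/2}\circ\theta_{\sigma_1},&\sigma_1\le r_{n+1}^{\varepsilon/2}(\tilde\Phi_0),\end{cases}$$ where $\theta_s$ is the shift: $N_t\circ\theta_s=N_{s+t}$ and $\tilde\Phi_t\circ\theta_s=\tilde\Phi_{s+t}$. Then all these objects are well defined: every $v_n$ is a bounded Borel function on $\mathbb R_+^2$, all the expectations above are finite (the random variables are integrable), almost surely $t\mapsto e^{-\lambda t}g(\tilde\Phi_t)$ is integrable on $[0,\sigma_n]$, and the infima defining $J_0v_n$ and $V_n$ are finite. Moreover: 1. $v_n(\phi)=V_n(\phi)$ for every $n\ge1$ and $\phi\in\mathbb R_+^2$. 2. For every $n\ge1$, $\varepsilon\ge0$ and $\phi\in\mathbb R_+^2$, $S_n^\varepsilon$ is an $\mathbb F$-stopping time with $S_n^\varepsilon\le\sigma_n$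 almost surely, the random variable $\int_0^{S_n^\varepsilon}e^{-\lambda t}g(\tilde\Phi_t)\,dt$ is integrable, and $$\mathbb E_0^{\phi}\Big[\int_0^{S_n^\varepsilon}e^{-\lambda t}g(\tilde\Phi_t)\,dt\Big]\le v_n(\phi)+\varepsilon .$$ So $S_n^\varepsilon$ is $\varepsilon$-optimal for $V_n$. -/

import Mathlib

open MeasureTheory ProbabilityTheory
open scoped ENNReal NNReal

noncomputable section

namespace PoissonDisorder

/-! ## Poisson processes, their jump times and their filtration -/

/-- A path of a counting process: the number of jumps up to each time. -/
abbrev CountPath : Type := ℝ≥0 → ℕ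

/-- The `n`-th jump time `σ_n = inf {t : N_t ≥ N_0 + n}` of a counting path (`∞` if there are
fewer than `n` jumps); `σ_0 = 0`. -/
def jumpTime (p : CountPath) (n : ℕ) : ℝ≥0∞ :=
  ⨅ (t : ℝ≥0) (_ : p 0 + n ≤ p t), (t : ℝ≥0∞)

/-- The shift of paths, `N_t ∘ θ_s = N_{s+t}`. -/
def shift (s : ℝ≥0) (p : CountPath) : CountPath := fun t => p (s + t)

/-- The path `t ↦ N_t(ω)` of a process. -/
def pathOf {Ω : Type*} (N : ℝ≥0 → Ω → ℕ) (ω : Ω) : CountPath := fun t => N t ω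

/-- `N` is a homogeneous Poisson process of rate `rate` under `P`: a counting process (started at
`0`, nondecreasing, right-continuous, with jumps of size one) whose successive waiting times
between jumps are independent and exponentially distributed with parameter `rate`. -/
structure IsPoissonProcess {Ω : Type*} [MeasurableSpace Ω] (N : ℝ≥0 → Ω → ℕ) (rate : ℝ)
    (P : Measure Ω) : Prop where
  measurable : ∀ t, Measurable (N t)
  start : ∀ ω, N 0 ω = 0
  mono : ∀ ω, Monotone (pathOf N ω)
  right_continuous : ∀ ω t, ContinuousWithinAt (pathOf N ω) (Set.Ici t) t
  /-- no value is skipped: all jumps have size one -/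
  unit_jumps : ∀ ω t k, k ≤ N t ω → ∃ s, N s ω = k
  indep_waiting : iIndepFun
    (fun (n : ℕ) ω => jumpTime (pathOf N ω) (n + 1) - jumpTime (pathOf N ω) n) P
  law_waiting : ∀ n : ℕ,
    P.map (fun ω => jumpTime (pathOf N ω) (n + 1) - jumpTime (pathOf N ω) n)
      = (expMeasure rate).map ENNReal.ofReal

/-- The natural filtration `σ(N_s ; s ≤ t)`, augmented with the `P`-null events: an event belongs
to the `t`-th σ-algebra iff it agrees `P`-a.s. with an event of `σ(N_s ; s ≤ t)`. -/
def completedFiltration {Ω : Type*} [mΩ : MeasurableSpace Ω] (N : ℝ≥0 → Ω → ℕ)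
    (P : Measure Ω) : Filtration ℝ≥0 mΩ where
  seq t := mΩ ⊓ eventuallyMeasurableSpace
    (⨆ s : Set.Iic t, MeasurableSpace.comap (N s) inferInstance) (ae P)
  mono' := by
    intro s t hst
    refine inf_le_inf le_rfl ?_
    rintro A ⟨B, hB, hAB⟩
    have hle : (⨆ u : Set.Iic s, MeasurableSpace.comap (N u) inferInstance)
        ≤ ⨆ u : Set.Iic t, MeasurableSpace.comap (N u) (inferInstance : MeasurableSpace ℕ) :=
      iSup_le fun u => le_iSup
        (fun u : Set.Iic t => MeasurableSpace.comap (N u) (inferInstance : MeasurableSpace ℕ))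
        ⟨u.1, le_trans u.2 hst⟩
    exact ⟨B, hle B hB, hAB⟩
  le' := fun _ => inf_le_left

/-- The filtration `𝔽`: the right-continuous enlargement of the natural filtration of `N` with
the `P`-null events. -/
def obsFiltration {Ω : Type*} [mΩ : MeasurableSpace Ω] (N : ℝ≥0 → Ω → ℕ)
    (P : Measure Ω) : Filtration ℝ≥0 mΩ :=
  (completedFiltration N P).rightCont

/-! ## The sufficient statistic -/

/-- The parameters: the disorder rate `lam`, the rate `mu` of the Poisson process, the cost `c`,
and the mean `m` of the change of the rate. -/
structure Params where
  lam : ℝ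
  mu : ℝ
  c : ℝ
  m : ℝ

/-- The state space `ℝ₊²`. -/
def quadrant : Set (ℝ × ℝ) := {φ | 0 ≤ φ.1 ∧ 0 ≤ φ.2}

/-- `x(t, a)`, the solution of `x' = (λ + 1) x + λ (1 - m) / √2`, `x(0) = a`. -/
def xFlow (q : Params) (t a : ℝ) : ℝ :=
  -(q.lam * (1 - q.m) / (√2 * (q.lam + 1)))
    + Real.exp ((q.lam + 1) * t) * (a + q.lam * (1 - q.m) / (√2 * (q.lam + 1)))

open Classical in
/-- `y(t, b)`, the solution of `y' = (λ - 1) y + λ (1 + m) / √2`, `y(0) = b`. -/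
def yFlow (q : Params) (t b : ℝ) : ℝ :=
  if q.lam = 1 then b + (1 + q.m) / √2 * t
  else -(q.lam * (1 + q.m) / (√2 * (q.lam - 1)))
    + Real.exp ((q.lam - 1) * t) * (b + q.lam * (1 + q.m) / (√2 * (q.lam - 1)))

/-- The motion between jumps. -/
def flow (q : Params) (t : ℝ) (φ : ℝ × ℝ) : ℝ × ℝ := (xFlow q t φ.1, yFlow q t φ.2)

/-- The effect of a jump. -/
def jumpMap (q : Params) (φ : ℝ × ℝ) : ℝ × ℝ :=
  ((1 - 1 / q.mu) * φ.1, (1 + 1 / q.mu) * φ.2)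

/-- The state right after the `n`-th jump of the path `p`, starting from `φ`. -/
def stateAtJump (q : Params) (φ : ℝ × ℝ) (p : CountPath) : ℕ → ℝ × ℝ
  | 0 => φ
  | n + 1 => jumpMap q
      (flow q ((jumpTime p (n + 1)).toReal - (jumpTime p n).toReal) (stateAtJump q φ p n))

/-- The sufficient statistic `Φ̃_t` started from `φ` and driven by the path `p`. It solves
`dΦ⁰ = ((λ + 1) Φ⁰ + λ (1 - m) / √2) dt - (1 / μ) Φ⁰_{t-} dN`,
`dΦ¹ = ((λ - 1) Φ¹ + λ (1 + m) / √2) dt + (1 / μ) Φ¹_{t-} dN`. -/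
def statistic (q : Params) (φ : ℝ × ℝ) (p : CountPath) (t : ℝ≥0) : ℝ × ℝ :=
  flow q ((t : ℝ) - (jumpTime p (p t - p 0)).toReal) (stateAtJump q φ p (p t - p 0))

/-! ## Costs, value functions and the single-jump operator -/

/-- The running cost function `g`. -/
def g (q : Params) (φ : ℝ × ℝ) : ℝ := φ.1 + φ.2 - q.lam / q.c * √2

/-- The discounted running cost rate `e^{-λ t} g(Φ̃_t)` at time `t ≥ 0`. -/
def costRate (q : Params) (φ : ℝ × ℝ) (p : CountPath) (t : ℝ) : ℝ :=
  Real.exp (-q.lam * t) * g q (statistic q φ p t.toNNReal)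

/-- The times `t ∈ [0, T]`, `t < ∞`, where `T ∈ [0, ∞]`. -/
def timesUpTo (T : ℝ≥0∞) : Set ℝ := {t | 0 ≤ t ∧ ENNReal.ofReal t ≤ T}

/-- `∫_0^T e^{-λ t} g(Φ̃_t) dt`. -/
def runCost (q : Params) (φ : ℝ × ℝ) (p : CountPath) (T : ℝ≥0∞) : ℝ :=
  ∫ t in timesUpTo T, costRate q φ p t

/-- The set of expected costs `E [∫_0^{τ ∧ σ_n} e^{-λ t} g(Φ̃_t) dt]`, over all stopping times. -/
def truncatedCosts {Ω : Type*} [MeasurableSpace Ω] (q : Params) (P : Measure Ω)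
    (N : ℝ≥0 → Ω → ℕ) (n : ℕ) (φ : ℝ × ℝ) : Set ℝ :=
  {r | ∃ τ : Ω → ℝ≥0∞, IsStoppingTime (obsFiltration N P) τ ∧
    r = ∫ ω, runCost q φ (pathOf N ω) (min (τ ω) (jumpTime (pathOf N ω) n)) ∂P}

/-- The truncated value function `V_n`. -/
def truncatedValue {Ω : Type*} [MeasurableSpace Ω] (q : Params) (P : Measure Ω)
    (N : ℝ≥0 → Ω → ℕ) (n : ℕ) (φ : ℝ × ℝ) : ℝ :=
  sInf (truncatedCosts q P N n φ)

open Classical in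
/-- The pathwise cost
`∫_0^{t ∧ σ_1} e^{-λ u} g(Φ̃_u) du + 1_{t ≥ σ_1} e^{-λ σ_1} w(Φ̃_{σ_1})`. -/
def singleJumpCost (q : Params) (w : ℝ × ℝ → ℝ) (t : ℝ≥0∞) (φ : ℝ × ℝ) (p : CountPath) : ℝ :=
  runCost q φ p (min t (jumpTime p 1)) +
    if jumpTime p 1 ≤ t then
      Real.exp (-q.lam * (jumpTime p 1).toReal) * w (statistic q φ p (jumpTime p 1).toNNReal)
    else 0

/-- `J w (t, φ)`, the expectation of `singleJumpCost`. -/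
def opJ {Ω : Type*} [MeasurableSpace Ω] (q : Params) (P : Measure Ω) (N : ℝ≥0 → Ω → ℕ)
    (w : ℝ × ℝ → ℝ) (t : ℝ≥0∞) (φ : ℝ × ℝ) : ℝ :=
  ∫ ω, singleJumpCost q w t φ (pathOf N ω) ∂P

/-- `J_0 w (φ) = inf_{t ∈ [0, ∞]} J w (t, φ)`. -/
def opJ₀ {Ω : Type*} [MeasurableSpace Ω] (q : Params) (P : Measure Ω) (N : ℝ≥0 → Ω → ℕ)
    (w : ℝ × ℝ → ℝ) (φ : ℝ × ℝ) : ℝ :=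
  ⨅ t : ℝ≥0∞, opJ q P N w t φ

/-- The iterates `v_0 = 0`, `v_n = J_0 v_{n-1}`. -/
def iterate {Ω : Type*} [MeasurableSpace Ω] (q : Params) (P : Measure Ω) (N : ℝ≥0 → Ω → ℕ) :
    ℕ → ℝ × ℝ → ℝ
  | 0 => fun _ => 0
  | n + 1 => opJ₀ q P N (iterate q P N n)

/-! ## The ε-optimal stopping times -/

open Classical in
/-- `r_n^ε(φ) = inf {s ∈ (0, ∞] : J v_n (s, φ) ≤ J_0 v_n (φ) + ε}`, and `0` if there is no such
`s` (then the infimum `J_0 v_n (φ)` is attained at `s = 0` only, and `ε = 0`). -/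
def waitTime {Ω : Type*} [MeasurableSpace Ω] (q : Params) (P : Measure Ω) (N : ℝ≥0 → Ω → ℕ)
    (n : ℕ) (ε : ℝ) (φ : ℝ × ℝ) : ℝ≥0∞ :=
  if ∃ s : ℝ≥0∞, 0 < s ∧ opJ q P N (iterate q P N n) s φ
      ≤ opJ₀ q P N (iterate q P N n) φ + ε
  then sInf {s : ℝ≥0∞ | 0 < s ∧ opJ q P N (iterate q P N n) s φ
      ≤ opJ₀ q P N (iterate q P N n) φ + ε}
  else 0

/-- `S_n^ε` for `n ≥ 1`, as a functional of the initial state and the path of the counting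
process; composition with `θ_{σ_1}` shifts the path and moves the initial state to `Φ̃_{σ_1}`.
(The value at `n = 0` is not used.) -/
def epsTime {Ω : Type*} [MeasurableSpace Ω] (q : Params) (P : Measure Ω) (N : ℝ≥0 → Ω → ℕ) :
    ℕ → ℝ → ℝ × ℝ → CountPath → ℝ≥0∞
  | 0, _, _, _ => 0
  | 1, ε, φ, p => min (waitTime q P N 0 ε φ) (jumpTime p 1)
  | n + 2, ε, φ, p =>
      if waitTime q P N (n + 1) (ε / 2) φ < jumpTime p 1 then waitTime q P N (n + 1) (ε / 2) φ
      else jumpTime p 1 + epsTime q P N (n + 1) (ε / 2)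
        (statistic q φ p (jumpTime p 1).toNNReal) (shift (jumpTime p 1).toNNReal p)

end PoissonDisorder

end

open PoissonDisorder

open PoissonDisorder

/-! Between jumps the statistic follows a deterministic flow, and the waiting times are independent
exponentials. Along almost every path the cost up to `T ∧ σ_n` is therefore a functional `seqCost`
of the waiting times (`IsCountingPath.runCost_eq_seqCost`), recursive in the first wait: the cost of
the flow until the first jump, then the discounted cost of the problem with one jump fewer,
restarted from the post-jump state. The optimality argument takes place on sequences of waiting
times and is then pulled back to `Ω`.

For sequences the theorem is dynamic programming. Fubini in the first wait (`integral_seqCost_succ`)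
expresses the mean cost of "wait `r`; if a jump intervenes, continue with `S`" through the mean cost
of `S` from the post-jump state. Induction then gives both inequalities: a rule whose `k`-th wait
depends only on the first `k` waiting times costs at least the value
(`value_le_integral_seqCost_stopAt`), and the explicit rule costs at most the value plus `ε`
(`integral_seqCost_seqEps_le`): `ε/2` is lost on the first wait and at most `ε/2` later, as
discounting does not amplify errors. The case `ε = 0` is included because the mean one-step cost is
continuous on the compact space `[0, ∞]`, so a minimiser exists.

Integrability rests on `μ > 1`: the statistic grows at most like `e^{(λ+1)t}`, which discounting
reduces to `e^t`, and `e^x` is integrable for the exponential law of rate `μ`. Independence makes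
`e^{w_0 + ⋯ + w_{n-1}}` an integrable bound over `n` legs.

The bridge to stopping times is `IsCountingPath.min_eq_min_stopRule`. For a stopping time `τ`, the
event `{τ < r}` agrees almost surely with a property of the path up to `r`. While exactly `k` jumps
have occurred, that path is determined by the first `k` waiting times, so between jumps `τ` is a
nonanticipating rule. Conversely, the explicit times are stopping times because the path stopped at
`t` already decides whether they are at most `t` (`epsTime_congr`). -/

namespace PoissonDisorder

/-! ## Growth of the flow -/

/-- The standing assumptions on the parameters. -/
structure Params.Admissible (q : Params) : Prop where
  lam_pos : 0 < q.lam
  one_lt_mu : 1 < q.mu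
  m_mem : q.m ∈ Set.Ioo (-1 : ℝ) 1

/-- The linear weight that controls the growth of costs. -/
def weight (φ : ℝ × ℝ) : ℝ := 1 + φ.1 + φ.2

/-- The state right after a first jump at time `x`. -/
noncomputable def afterJump (q : Params) (φ : ℝ × ℝ) (x : ℝ) : ℝ × ℝ := jumpMap q (flow q x φ)

/-- The discounted cost of following the flow up to time `r`. -/
noncomputable def legCost (q : Params) (φ : ℝ × ℝ) (r : ℝ) : ℝ :=
  ∫ u in (0 : ℝ)..r, Real.exp (-q.lam * u) * g q (flow q u φ)

lemma measurableSet_quadrant : MeasurableSet quadrant :=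
  (measurableSet_le measurable_const measurable_fst).inter
    (measurableSet_le measurable_const measurable_snd)

lemma one_le_weight {φ : ℝ × ℝ} (h : φ ∈ quadrant) : 1 ≤ weight φ := by
  have h1 := h.1
  have h2 := h.2
  unfold weight; linarith

lemma continuous_flow (q : Params) : Continuous fun z : ℝ × (ℝ × ℝ) => flow q z.1 z.2 := by
  unfold flow xFlow yFlow
  split_ifs <;> fun_prop

lemma continuous_jumpMap (q : Params) : Continuous (jumpMap q) := by
  unfold jumpMap; fun_prop

lemma continuous_g (q : Params) : Continuous (g q) := by
  unfold g; fun_prop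

lemma continuous_afterJump (q : Params) :
    Continuous fun z : (ℝ × ℝ) × ℝ => afterJump q z.1 z.2 :=
  (continuous_jumpMap q).comp ((continuous_flow q).comp (continuous_snd.prodMk continuous_fst))

lemma continuous_flow_cost (q : Params) :
    Continuous fun z : (ℝ × ℝ) × ℝ => Real.exp (-q.lam * z.2) * g q (flow q z.2 z.1) := by
  have h : Continuous fun z : (ℝ × ℝ) × ℝ => g q (flow q z.2 z.1) :=
    (continuous_g q).comp ((continuous_flow q).comp (continuous_snd.prodMk continuous_fst))
  fun_prop

lemma continuous_flow_cost_right (q : Params) (φ : ℝ × ℝ) :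
    Continuous fun u : ℝ => Real.exp (-q.lam * u) * g q (flow q u φ) :=
  (continuous_flow_cost q).comp (continuous_const.prodMk continuous_id)

lemma continuous_legCost (q : Params) :
    Continuous fun z : (ℝ × ℝ) × ℝ => legCost q z.1 z.2 := by
  unfold legCost
  have := intervalIntegral.continuous_parametric_intervalIntegral_of_continuous
    (μ := volume) (a₀ := (0 : ℝ))
    (f := fun (z : (ℝ × ℝ) × ℝ) u => Real.exp (-q.lam * u) * g q (flow q u z.1))
    ((continuous_flow_cost q).comp
      ((continuous_fst.comp continuous_fst).prodMk continuous_snd)) continuous_snd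
  exact this

lemma flow_zero (q : Params) (φ : ℝ × ℝ) : flow q 0 φ = φ := by
  unfold flow xFlow yFlow
  ext <;> simp

lemma xFlow_bounds {q : Params} (hq : q.Admissible) :
    ∃ K : ℝ, 0 ≤ K ∧ ∀ a t : ℝ, 0 ≤ a → 0 ≤ t →
      0 ≤ xFlow q t a ∧ xFlow q t a ≤ (a + K) * Real.exp ((q.lam + 1) * t) := by
  have hl := hq.lam_pos
  have hm := hq.m_mem.2
  have hK : 0 ≤ q.lam * (1 - q.m) / (√2 * (q.lam + 1)) :=
    div_nonneg (mul_nonneg hl.le (by linarith)) (by positivity)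
  refine ⟨_, hK, fun a t ha ht => ?_⟩
  have he : 1 ≤ Real.exp ((q.lam + 1) * t) := Real.one_le_exp (by positivity)
  unfold xFlow
  constructor <;> nlinarith

lemma yFlow_bounds {q : Params} (hq : q.Admissible) :
    ∃ K : ℝ, 0 ≤ K ∧ ∀ b t : ℝ, 0 ≤ b → 0 ≤ t →
      0 ≤ yFlow q t b ∧ yFlow q t b ≤ (b + K) * Real.exp ((q.lam + 1) * t) := by
  have hl := hq.lam_pos
  have hm := hq.m_mem.1
  by_cases h1 : q.lam = 1
  · have hK : 0 ≤ (1 + q.m) / √2 := div_nonneg (by linarith) (by positivity)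
    refine ⟨_, hK, fun b t hb ht => ?_⟩
    have he : (q.lam + 1) * t + 1 ≤ Real.exp ((q.lam + 1) * t) := Real.add_one_le_exp _
    have h2 : 0 ≤ q.lam * t := by positivity
    have h3 : t ≤ Real.exp ((q.lam + 1) * t) := by linarith
    have h4 : 1 ≤ Real.exp ((q.lam + 1) * t) := by linarith
    rw [yFlow, if_pos h1]
    constructor
    · positivity
    · nlinarith
  · refine ⟨|q.lam * (1 + q.m) / (√2 * (q.lam - 1))|, abs_nonneg _, fun b t hb ht => ?_⟩
    set κ := q.lam * (1 + q.m) / (√2 * (q.lam - 1)) with hκ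
    have he : 1 ≤ Real.exp ((q.lam + 1) * t) := Real.one_le_exp (by positivity)
    have he' : Real.exp ((q.lam - 1) * t) ≤ Real.exp ((q.lam + 1) * t) :=
      Real.exp_le_exp.2 (by nlinarith)
    have he0 : 0 < Real.exp ((q.lam - 1) * t) := Real.exp_pos _
    -- The offset `κ` has the sign of `λ - 1`, hence of `e^{(λ-1)t} - 1`. This keeps the second
    -- coordinate nonnegative both for `λ < 1` and for `λ > 1`.
    have hprod : 0 ≤ κ * (Real.exp ((q.lam - 1) * t) - 1) := by
      rcases lt_or_gt_of_ne h1 with h | h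
      · have : κ ≤ 0 := div_nonpos_of_nonneg_of_nonpos
          (mul_nonneg hl.le (by linarith))
          (mul_nonpos_of_nonneg_of_nonpos (by positivity) (by linarith))
        have h5 : Real.exp ((q.lam - 1) * t) ≤ 1 := Real.exp_le_one_iff.2 (by nlinarith)
        exact mul_nonneg_of_nonpos_of_nonpos this (by linarith)
      · have : 0 ≤ κ := div_nonneg (mul_nonneg hl.le (by linarith))
          (mul_nonneg (by positivity) (by linarith))
        have h5 : 1 ≤ Real.exp ((q.lam - 1) * t) := Real.one_le_exp (by nlinarith)
        exact mul_nonneg this (by linarith)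
    have hprod' : κ * (Real.exp ((q.lam - 1) * t) - 1)
        ≤ |κ| * Real.exp ((q.lam + 1) * t) := by
      refine (le_abs_self _).trans ?_
      rw [abs_mul]
      refine mul_le_mul_of_nonneg_left ?_ (abs_nonneg _)
      rw [abs_le]; constructor <;> linarith
    rw [yFlow, if_neg h1]
    constructor
    · nlinarith
    · nlinarith

lemma flow_mem_quadrant {q : Params} (hq : q.Admissible) {φ : ℝ × ℝ} (hφ : φ ∈ quadrant)
    {t : ℝ} (ht : 0 ≤ t) : flow q t φ ∈ quadrant := by
  obtain ⟨_, _, hx⟩ := xFlow_bounds hq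
  obtain ⟨_, _, hy⟩ := yFlow_bounds hq
  exact ⟨(hx _ _ hφ.1 ht).1, (hy _ _ hφ.2 ht).1⟩

lemma jumpMap_mem_quadrant {q : Params} (hq : q.Admissible) {φ : ℝ × ℝ} (hφ : φ ∈ quadrant) :
    jumpMap q φ ∈ quadrant := by
  have hmu := hq.one_lt_mu
  have h1 : 1 / q.mu ≤ 1 := by rw [div_le_one (by linarith)]; exact hmu.le
  have h2 : 0 ≤ 1 / q.mu := by positivity
  exact ⟨mul_nonneg (by linarith) hφ.1, mul_nonneg (by linarith) hφ.2⟩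

lemma afterJump_mem_quadrant {q : Params} (hq : q.Admissible) {φ : ℝ × ℝ} (hφ : φ ∈ quadrant)
    {x : ℝ} (hx : 0 ≤ x) : afterJump q φ x ∈ quadrant :=
  jumpMap_mem_quadrant hq (flow_mem_quadrant hq hφ hx)

lemma exists_weight_flow_le {q : Params} (hq : q.Admissible) :
    ∃ B : ℝ, 0 ≤ B ∧ ∀ φ ∈ quadrant, ∀ t : ℝ, 0 ≤ t →
      weight (flow q t φ) ≤ B * weight φ * Real.exp ((q.lam + 1) * t) := by
  obtain ⟨K, hK, hx⟩ := xFlow_bounds hq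
  obtain ⟨L, hL, hy⟩ := yFlow_bounds hq
  refine ⟨1 + K + L, by positivity, fun φ hφ t ht => ?_⟩
  have h1 := (hx _ _ hφ.1 ht).2
  have h2 := (hy _ _ hφ.2 ht).2
  have hl := hq.lam_pos
  have he : 1 ≤ Real.exp ((q.lam + 1) * t) := Real.one_le_exp (by positivity)
  have hw := one_le_weight hφ
  have h3 : (1 + (φ.1 + K) + (φ.2 + L)) ≤ (1 + K + L) * weight φ := by
    unfold weight at *; nlinarith
  calc weight (flow q t φ) ≤ (1 + (φ.1 + K) + (φ.2 + L)) * Real.exp ((q.lam + 1) * t) := by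
        unfold weight flow; dsimp only; nlinarith
    _ ≤ _ := mul_le_mul_of_nonneg_right h3 (Real.exp_pos _).le

lemma weight_jumpMap_le {q : Params} (hq : q.Admissible) {φ : ℝ × ℝ} (hφ : φ ∈ quadrant) :
    weight (jumpMap q φ) ≤ 2 * weight φ := by
  have hmu := hq.one_lt_mu
  have h1 : 1 / q.mu ≤ 1 := by rw [div_le_one (by linarith)]; exact hmu.le
  have h2 : 0 ≤ 1 / q.mu := by positivity
  have h3 := hφ.1
  have h4 := hφ.2
  unfold weight jumpMap
  dsimp only
  nlinarith

lemma exists_abs_g_le (q : Params) :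
    ∃ C : ℝ, 0 ≤ C ∧ ∀ φ ∈ quadrant, |g q φ| ≤ C * weight φ := by
  refine ⟨1 + |q.lam / q.c * √2|, by positivity, fun φ hφ => ?_⟩
  have h3 := hφ.1
  have h4 := hφ.2
  have h5 := abs_nonneg (q.lam / q.c * √2)
  have h6 := abs_le.1 (le_refl |q.lam / q.c * √2|)
  unfold g weight
  rw [abs_le]
  constructor <;> nlinarith

/-- The running cost along the flow grows at most like `e^u`. -/
lemma exists_abs_flow_cost_le {q : Params} (hq : q.Admissible) :
    ∃ A : ℝ, 0 ≤ A ∧ ∀ φ ∈ quadrant, ∀ u : ℝ, 0 ≤ u →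
      |Real.exp (-q.lam * u) * g q (flow q u φ)| ≤ A * weight φ * Real.exp u := by
  obtain ⟨B, hB, hf⟩ := exists_weight_flow_le hq
  obtain ⟨C, hC, hg⟩ := exists_abs_g_le q
  refine ⟨C * B, by positivity, fun φ hφ u hu => ?_⟩
  rw [abs_mul, Real.abs_exp]
  calc Real.exp (-q.lam * u) * |g q (flow q u φ)|
      ≤ Real.exp (-q.lam * u) * (C * (B * weight φ * Real.exp ((q.lam + 1) * u))) := by
        refine mul_le_mul_of_nonneg_left ((hg _ (flow_mem_quadrant hq hφ hu)).trans ?_)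
          (Real.exp_pos _).le
        exact mul_le_mul_of_nonneg_left (hf φ hφ u hu) hC
    _ = C * B * weight φ * (Real.exp (-q.lam * u) * Real.exp ((q.lam + 1) * u)) := by ring
    _ = C * B * weight φ * Real.exp u := by rw [← Real.exp_add]; ring_nf

lemma exists_abs_legCost_le {q : Params} (hq : q.Admissible) :
    ∃ A : ℝ, 0 ≤ A ∧ ∀ φ ∈ quadrant, ∀ r : ℝ, 0 ≤ r →
      |legCost q φ r| ≤ A * weight φ * Real.exp r := by
  obtain ⟨A, hA, h⟩ := exists_abs_flow_cost_le hq
  refine ⟨A, hA, fun φ hφ r hr => ?_⟩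
  have hw := one_le_weight hφ
  have h1 : |legCost q φ r| ≤ ∫ u in (0 : ℝ)..r, A * weight φ * Real.exp u := by
    unfold legCost
    rw [← Real.norm_eq_abs]
    refine intervalIntegral.norm_integral_le_of_norm_le hr ?_ ?_
    · exact Filter.Eventually.of_forall fun u hu => h φ hφ u hu.1.le
    · exact (by fun_prop : Continuous fun u : ℝ => A * weight φ * Real.exp u).intervalIntegrable _ _
  refine h1.trans ?_
  rw [intervalIntegral.integral_const_mul, integral_exp]
  refine mul_le_mul_of_nonneg_left ?_ (by positivity)
  simp

lemma exists_weight_afterJump_le {q : Params} (hq : q.Admissible) :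
    ∃ B : ℝ, 0 ≤ B ∧ ∀ φ ∈ quadrant, ∀ x : ℝ, 0 ≤ x →
      Real.exp (-q.lam * x) * weight (afterJump q φ x) ≤ B * weight φ * Real.exp x := by
  obtain ⟨B, hB, hf⟩ := exists_weight_flow_le hq
  refine ⟨2 * B, by positivity, fun φ hφ x hx => ?_⟩
  calc Real.exp (-q.lam * x) * weight (afterJump q φ x)
      ≤ Real.exp (-q.lam * x) * (2 * (B * weight φ * Real.exp ((q.lam + 1) * x))) := by
        refine mul_le_mul_of_nonneg_left ((weight_jumpMap_le hq (flow_mem_quadrant hq hφ hx)).trans ?_)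
          (Real.exp_pos _).le
        exact mul_le_mul_of_nonneg_left (hf φ hφ x hx) (by norm_num)
    _ = 2 * B * weight φ * (Real.exp (-q.lam * x) * Real.exp ((q.lam + 1) * x)) := by ring
    _ = 2 * B * weight φ * Real.exp x := by rw [← Real.exp_add]; ring_nf

/-- The cost of a leg is bounded below, uniformly in the initial state. -/
lemma legCost_ge {q : Params} (hq : q.Admissible) {φ : ℝ × ℝ} (hφ : φ ∈ quadrant)
    {r : ℝ} (hr : 0 ≤ r) : -(|q.lam / q.c * √2| / q.lam) ≤ legCost q φ r := by
  have hl := hq.lam_pos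
  -- On the quadrant `g` is at least `-λ√2/c`, and `e^{-λu}` has total mass `1/λ` on the half-line.
  have h0 : ∫ u in (0 : ℝ)..r, Real.exp (-q.lam * u) * (-|q.lam / q.c * √2|) ≤ legCost q φ r := by
    refine intervalIntegral.integral_mono_on hr ?_ ?_ fun u hu => ?_
    · exact (by fun_prop : Continuous fun u : ℝ =>
        Real.exp (-q.lam * u) * (-|q.lam / q.c * √2|)).intervalIntegrable _ _
    · exact (continuous_flow_cost_right q φ).intervalIntegrable _ _
    · refine mul_le_mul_of_nonneg_left ?_ (Real.exp_pos _).le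
      have h := flow_mem_quadrant hq hφ hu.1
      have h1 := h.1
      have h2 := h.2
      have h3 := le_abs_self (q.lam / q.c * √2)
      unfold g; linarith
  refine le_trans ?_ h0
  rw [intervalIntegral.integral_mul_const, intervalIntegral.integral_comp_mul_left
    (f := fun x => Real.exp x) (neg_ne_zero.2 hl.ne'), integral_exp]
  simp only [mul_zero, Real.exp_zero, smul_eq_mul]
  have he : 0 < Real.exp (-q.lam * r) := Real.exp_pos _
  have hC := abs_nonneg (q.lam / q.c * √2)
  rw [div_eq_mul_inv, inv_neg]
  have hi : 0 ≤ q.lam⁻¹ := by positivity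
  have : 0 ≤ |q.lam / q.c * √2| * q.lam⁻¹ * Real.exp (-q.lam * r) := by positivity
  nlinarith

/-! ## Sequences of waiting times -/

/-- The sequence `x, w 0, w 1, …`. -/
def consSeq (x : ℝ) (w : ℕ → ℝ) : ℕ → ℝ
  | 0 => x
  | n + 1 => w n

/-- The sequence `w 1, w 2, …`. -/
def tailSeq (w : ℕ → ℝ) : ℕ → ℝ := fun n => w (n + 1)

@[simp] lemma consSeq_zero (x : ℝ) (w : ℕ → ℝ) : consSeq x w 0 = x := rfl

@[simp] lemma consSeq_succ (x : ℝ) (w : ℕ → ℝ) (n : ℕ) : consSeq x w (n + 1) = w n := rfl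

@[simp] lemma tailSeq_consSeq (x : ℝ) (w : ℕ → ℝ) : tailSeq (consSeq x w) = w := rfl

lemma measurable_consSeq : Measurable fun z : ℝ × (ℕ → ℝ) => consSeq z.1 z.2 := by
  refine measurable_pi_iff.2 fun n => ?_
  cases n with
  | zero => exact measurable_fst
  | succ n => exact (measurable_pi_apply n).comp measurable_snd

lemma measurable_tailSeq : Measurable tailSeq :=
  measurable_pi_iff.2 fun n => measurable_pi_apply (n + 1)

/-- The law of a sequence of independent exponential waiting times. -/
noncomputable def waitLaw (rate : ℝ) : Measure (ℕ → ℝ) :=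
  Measure.infinitePi fun _ => expMeasure rate

lemma isProbabilityMeasure_waitLaw {rate : ℝ} (h : 0 < rate) :
    IsProbabilityMeasure (waitLaw rate) := by
  have := isProbabilityMeasure_expMeasure h
  unfold waitLaw; infer_instance

/-- Regeneration of the waiting times: a fresh exponential put in front of an independent sequence
reproduces the law. Every use of Fubini in the first wait goes through this identity, checked on
cylinders. -/
lemma map_consSeq_prod_waitLaw {rate : ℝ} (h : 0 < rate) :
    ((expMeasure rate).prod (waitLaw rate)).map (fun z => consSeq z.1 z.2) = waitLaw rate := by
  classical
  have := isProbabilityMeasure_expMeasure h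
  have := isProbabilityMeasure_waitLaw h
  refine Measure.eq_infinitePi _ fun s t ht => ?_
  -- The cylinder is enlarged to an initial segment of coordinates, with no constraint on the added
  -- ones, so that coordinate `0` is always present and can be split off.
  obtain ⟨M, hM⟩ : ∃ M, s ⊆ Finset.range (M + 1) :=
    ⟨s.sup id, fun i hi => Finset.mem_range_succ_iff.2 (Finset.le_sup (f := id) hi)⟩
  set t' : ℕ → Set ℝ := fun i => if i ∈ s then t i else Set.univ with ht'
  have htm : ∀ i, MeasurableSet (t' i) := fun i => by
    simp only [ht']; split_ifs
    exacts [ht i, MeasurableSet.univ]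
  have h1 : Set.pi (s : Set ℕ) t = Set.pi (Finset.range (M + 1) : Set ℕ) t' := by
    ext w
    simp only [Set.mem_pi, Finset.mem_coe, ht']
    constructor
    · intro hw i _
      split_ifs with hi
      exacts [hw i hi, trivial]
    · intro hw i hi
      simpa [hi] using hw i (hM hi)
  have h2 : ∏ i ∈ s, expMeasure rate (t i) = ∏ i ∈ Finset.range (M + 1), expMeasure rate (t' i) := by
    rw [← Finset.prod_subset hM (f := fun i => expMeasure rate (t' i))]
    · exact Finset.prod_congr rfl fun i hi => by simp [ht', hi]
    · intro i _ hi
      simp [ht', hi]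
  have h3 : (fun z : ℝ × (ℕ → ℝ) => consSeq z.1 z.2) ⁻¹' Set.pi (Finset.range (M + 1) : Set ℕ) t'
      = t' 0 ×ˢ Set.pi (Finset.range M : Set ℕ) (fun i => t' (i + 1)) := by
    ext z
    simp only [Set.mem_preimage, Set.mem_pi, Finset.mem_coe, Set.mem_prod, Finset.mem_range]
    constructor
    · exact fun hz => ⟨hz 0 (by omega), fun i hi => hz (i + 1) (by omega)⟩
    · rintro ⟨h0, hz⟩ i hi
      cases i with
      | zero => exact h0
      | succ i => exact hz i (by omega)
  rw [h1, h2, Measure.map_apply measurable_consSeq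
    (MeasurableSet.pi (Finset.countable_toSet _) fun i _ => htm i), h3, Measure.prod_prod, waitLaw,
    Measure.infinitePi_pi _ fun i _ => htm (i + 1), Finset.prod_range_succ', mul_comm]

lemma ae_pos_expMeasure {rate : ℝ} : ∀ᵐ x ∂(expMeasure rate), 0 < x := by
  rw [ae_iff]
  simp only [not_lt]
  change volume.withDensity (gammaPDF 1 rate) (Set.Iic 0) = 0
  rw [withDensity_apply _ measurableSet_Iic, setLIntegral_congr Iio_ae_eq_Iic.symm]
  exact lintegral_gammaPDF_of_nonpos le_rfl

lemma ae_ne_expMeasure {rate : ℝ} (a : ℝ) : ∀ᵐ x ∂(expMeasure rate), x ≠ a := by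
  have h : expMeasure rate ≪ volume := withDensity_absolutelyContinuous _ _
  exact h.ae_le (compl_mem_ae_iff.2 (measure_singleton a))

lemma ae_pos_waitLaw {rate : ℝ} (h : 0 < rate) : ∀ᵐ w ∂(waitLaw rate), ∀ i, 0 < w i := by
  have := isProbabilityMeasure_expMeasure h
  rw [ae_all_iff]
  intro i
  exact (measurePreserving_eval_infinitePi (fun _ : ℕ => expMeasure rate) i).quasiMeasurePreserving.ae
    ae_pos_expMeasure

/-- Against the density the integrand becomes `rate * e^{(1 - rate) x}`; this is where `μ > 1`
enters the integrability of costs. -/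
lemma integrable_exp_expMeasure {rate : ℝ} (h : 1 < rate) :
    Integrable (fun x => Real.exp x) (expMeasure rate) := by
  change Integrable _ (volume.withDensity (exponentialPDF rate))
  have hpdf : Measurable (exponentialPDF rate) := (measurable_exponentialPDFReal rate).ennreal_ofReal
  rw [integrable_withDensity_iff_integrable_smul' hpdf
    (Filter.Eventually.of_forall fun x => ENNReal.ofReal_lt_top)]
  have h1 : (fun x => (exponentialPDF rate x).toReal • Real.exp x)
      = Set.indicator (Set.Ici 0) (fun x => rate * Real.exp ((1 - rate) * x)) := by
    ext x
    rw [exponentialPDF_eq]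
    by_cases hx : 0 ≤ x
    · rw [if_pos hx, Set.indicator_of_mem (Set.mem_Ici.2 hx), ENNReal.toReal_ofReal (by positivity),
        smul_eq_mul, mul_assoc, ← Real.exp_add]
      ring_nf
    · rw [if_neg hx, Set.indicator_of_notMem (by simpa using hx)]
      simp
  rw [h1, integrable_indicator_iff measurableSet_Ici, integrableOn_Ici_iff_integrableOn_Ioi]
  exact (integrableOn_exp_mul_Ioi (by linarith) 0).const_mul rate

/-- The growth bound `e^{w_0 + ⋯ + w_{n-1}}`. -/
noncomputable def expSum (n : ℕ) (w : ℕ → ℝ) : ℝ := Real.exp (∑ i ∈ Finset.range n, w i)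

lemma expSum_succ (n : ℕ) (w : ℕ → ℝ) :
    expSum (n + 1) w = Real.exp (w 0) * expSum n (tailSeq w) := by
  rw [expSum, expSum, ← Real.exp_add, Finset.sum_range_succ']
  congr 1
  rw [add_comm]; rfl

lemma measurable_expSum (n : ℕ) : Measurable (expSum n) := by
  unfold expSum
  exact (Finset.measurable_sum _ fun i _ => measurable_pi_apply i).exp

lemma integrable_expSum {rate : ℝ} (h : 1 < rate) (n : ℕ) :
    Integrable (expSum n) (waitLaw rate) := by
  have h0 : 0 < rate := by linarith
  have := isProbabilityMeasure_expMeasure h0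
  have := isProbabilityMeasure_waitLaw h0
  induction n with
  | zero => exact (integrable_const (1 : ℝ)).congr (.of_forall fun w => by simp [expSum])
  | succ n ih =>
    rw [← map_consSeq_prod_waitLaw h0, integrable_map_measure
      (measurable_expSum _).aestronglyMeasurable measurable_consSeq.aemeasurable]
    refine ((integrable_exp_expMeasure h).mul_prod ih).congr ?_
    exact Filter.Eventually.of_forall fun z => by simp [expSum_succ]

/-! ## Costs as functionals of the waiting times -/

open Classical in
/-- The cost of stopping at `s` when the first jump comes at `x` and the discounted cost from then
on is `c`. -/
noncomputable def stepCost (q : Params) (φ : ℝ × ℝ) (s : ℝ≥0∞) (x c : ℝ) : ℝ :=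
  legCost q φ (min s (ENNReal.ofReal x)).toReal
    + if ENNReal.ofReal x ≤ s then Real.exp (-q.lam * x) * c else 0

/-- The running cost up to time `T` or the `n`-th jump, when the waiting times are `w`. -/
noncomputable def seqCost (q : Params) : ℕ → ℝ × ℝ → (ℕ → ℝ) → ℝ≥0∞ → ℝ
  | 0, _, _, _ => 0
  -- If `T` precedes the first jump the truncated difference is `0`, but `stepCost` then discards
  -- the continuation, so its value is immaterial.
  | n + 1, φ, w, T => stepCost q φ T (w 0)
      (seqCost q n (afterJump q φ (w 0)) (tailSeq w) (T - ENNReal.ofReal (w 0)))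

lemma Measurable.stepCost {α : Type*} [MeasurableSpace α] (q : Params) {φ : α → ℝ × ℝ}
    {s : α → ℝ≥0∞} {x c : α → ℝ} (hφ : Measurable φ) (hs : Measurable s) (hx : Measurable x)
    (hc : Measurable c) : Measurable fun a => stepCost q (φ a) (s a) (x a) (c a) := by
  unfold PoissonDisorder.stepCost
  refine Measurable.add ?_ (Measurable.ite (measurableSet_le hx.ennreal_ofReal hs) ?_
    measurable_const)
  · exact (continuous_legCost q).measurable.comp
      (hφ.prodMk (hs.min hx.ennreal_ofReal).ennreal_toReal)
  · exact ((hx.const_mul (-q.lam)).exp).mul hc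

lemma Measurable.seqCost {α : Type*} [MeasurableSpace α] (q : Params) (n : ℕ) {φ : α → ℝ × ℝ}
    {w : α → ℕ → ℝ} {T : α → ℝ≥0∞} (hφ : Measurable φ) (hw : Measurable w) (hT : Measurable T) :
    Measurable fun a => seqCost q n (φ a) (w a) (T a) := by
  induction n generalizing φ w T with
  | zero => exact measurable_const
  | succ n ih =>
    have h0 : Measurable fun a => w a 0 := (measurable_pi_apply 0).comp hw
    exact Measurable.stepCost q hφ hT h0
      (ih ((continuous_afterJump q).measurable.comp (hφ.prodMk h0)) (measurable_tailSeq.comp hw)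
        (hT.sub h0.ennreal_ofReal))

lemma stepCost_mono (q : Params) (φ : ℝ × ℝ) (s : ℝ≥0∞) (x : ℝ) {c d : ℝ} (h : c ≤ d) :
    stepCost q φ s x c ≤ stepCost q φ s x d := by
  unfold stepCost
  split_ifs
  · gcongr
  · exact le_rfl

lemma toReal_min_ofReal_le (s : ℝ≥0∞) {x : ℝ} (hx : 0 ≤ x) :
    (min s (ENNReal.ofReal x)).toReal ≤ x :=
  ENNReal.toReal_le_of_le_ofReal hx (min_le_right _ _)

lemma exists_abs_stepCost_le {q : Params} (hq : q.Admissible) :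
    ∃ A : ℝ, 0 ≤ A ∧ ∀ φ ∈ quadrant, ∀ s : ℝ≥0∞, ∀ x : ℝ, 0 ≤ x → ∀ c : ℝ,
      |stepCost q φ s x c| ≤ A * weight φ * Real.exp x + Real.exp (-q.lam * x) * |c| := by
  obtain ⟨A, hA, h⟩ := exists_abs_legCost_le hq
  refine ⟨A, hA, fun φ hφ s x hx c => ?_⟩
  have hw := one_le_weight hφ
  unfold stepCost
  refine (abs_add_le _ _).trans (add_le_add ?_ ?_)
  · refine (h φ hφ _ ENNReal.toReal_nonneg).trans ?_
    have := toReal_min_ofReal_le s hx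
    gcongr
  · split_ifs
    · rw [abs_mul, Real.abs_exp]
    · rw [abs_zero]; positivity

lemma exists_abs_stepCost_le_of_bounded {q : Params} (hq : q.Admissible) :
    ∃ A : ℝ, 0 ≤ A ∧ ∀ φ ∈ quadrant, ∀ s : ℝ≥0∞, ∀ x : ℝ, 0 ≤ x → ∀ c C : ℝ, |c| ≤ C →
      |stepCost q φ s x c| ≤ A * weight φ * Real.exp x + C := by
  obtain ⟨A, hA, h⟩ := exists_abs_stepCost_le hq
  refine ⟨A, hA, fun φ hφ s x hx c C hc => (h φ hφ s x hx c).trans ?_⟩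
  have hl := hq.lam_pos
  have he : Real.exp (-q.lam * x) ≤ 1 := Real.exp_le_one_iff.2 (by nlinarith)
  have := mul_le_of_le_one_left (abs_nonneg c) he
  linarith

lemma exists_abs_seqCost_le {q : Params} (hq : q.Admissible) (n : ℕ) :
    ∃ K : ℝ, 0 ≤ K ∧ ∀ φ ∈ quadrant, ∀ w : ℕ → ℝ, (∀ i, 0 < w i) → ∀ T : ℝ≥0∞,
      |seqCost q n φ w T| ≤ K * weight φ * expSum n w := by
  obtain ⟨A, hA, h⟩ := exists_abs_stepCost_le hq
  obtain ⟨B, hB, hb⟩ := exists_weight_afterJump_le hq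
  induction n with
  | zero => exact ⟨0, le_rfl, fun φ _ w _ T => by simp [seqCost]⟩
  | succ n ih =>
    obtain ⟨K, hK, ih⟩ := ih
    refine ⟨A + K * B, by positivity, fun φ hφ w hw T => ?_⟩
    have h0 := (hw 0).le
    have hwt := one_le_weight hφ
    have hS : 1 ≤ expSum n (tailSeq w) := Real.one_le_exp (Finset.sum_nonneg fun i _ => (hw _).le)
    have h1 := ih _ (afterJump_mem_quadrant hq hφ h0) (tailSeq w) (fun i => hw _)
      (T - ENNReal.ofReal (w 0))
    refine (h φ hφ T (w 0) h0 _).trans ?_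
    rw [expSum_succ]
    have h2 : Real.exp (-q.lam * w 0) * |seqCost q n (afterJump q φ (w 0)) (tailSeq w)
        (T - ENNReal.ofReal (w 0))| ≤ K * (B * weight φ * Real.exp (w 0)) * expSum n (tailSeq w) := by
      calc _ ≤ Real.exp (-q.lam * w 0)
            * (K * weight (afterJump q φ (w 0)) * expSum n (tailSeq w)) := by gcongr
        _ = K * (Real.exp (-q.lam * w 0) * weight (afterJump q φ (w 0)))
            * expSum n (tailSeq w) := by ring
        _ ≤ _ := by
          have := hb φ hφ (w 0) h0
          gcongr
    have h3 : A * weight φ * Real.exp (w 0)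
        ≤ A * weight φ * Real.exp (w 0) * expSum n (tailSeq w) :=
      le_mul_of_one_le_right (by positivity) hS
    calc _ ≤ _ := add_le_add h3 h2
      _ = _ := by ring

/-- Separates the first decision `r` from the continuation `S`. After this rewriting the dependence
on the later waits is confined to the last argument of `stepCost`. -/
lemma seqCost_succ_ite (q : Params) (n : ℕ) (φ : ℝ × ℝ) (w : ℕ → ℝ) (r S : ℝ≥0∞) :
    seqCost q (n + 1) φ w (if r < ENNReal.ofReal (w 0) then r else ENNReal.ofReal (w 0) + S)
      = stepCost q φ r (w 0) (seqCost q n (afterJump q φ (w 0)) (tailSeq w) S) := by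
  rw [seqCost]
  split_ifs with h
  · unfold stepCost
    rw [if_neg h.not_ge, if_neg h.not_ge]
  · rw [not_lt] at h
    unfold stepCost
    rw [if_pos le_self_add, if_pos h, ENNReal.add_sub_cancel_left ENNReal.ofReal_ne_top,
      min_eq_right h, min_eq_right le_self_add]

lemma integrable_seqCost {q : Params} (hq : q.Admissible) (n : ℕ) {φ : ℝ × ℝ} (hφ : φ ∈ quadrant)
    {T : (ℕ → ℝ) → ℝ≥0∞} (hT : Measurable T) :
    Integrable (fun w => seqCost q n φ w (T w)) (waitLaw q.mu) := by
  have h0 : 0 < q.mu := by linarith [hq.one_lt_mu]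
  obtain ⟨K, hK, h⟩ := exists_abs_seqCost_le hq n
  refine Integrable.mono' ((integrable_expSum hq.one_lt_mu n).const_mul (K * weight φ))
    (Measurable.seqCost q n measurable_const measurable_id hT).aestronglyMeasurable ?_
  filter_upwards [ae_pos_waitLaw h0] with w hw
  exact h φ hφ w hw _

/-- `stepCost` is affine in the continuation cost, and the constant part survives averaging because
the total mass is one. -/
lemma integral_stepCost_right {α : Type*} [MeasurableSpace α] (ν : Measure α)
    [IsProbabilityMeasure ν] (q : Params) (φ : ℝ × ℝ) (s : ℝ≥0∞) (x : ℝ) {c : α → ℝ}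
    (hc : Integrable c ν) :
    ∫ a, stepCost q φ s x (c a) ∂ν = stepCost q φ s x (∫ a, c a ∂ν) := by
  unfold stepCost
  split_ifs
  · rw [integral_add (integrable_const _) (hc.const_mul _), integral_const_mul]
    simp
  · simp

/-! ### Conditioning on the first waiting time -/

section OneStep

variable {q : Params} (hq : q.Admissible) (n : ℕ) {φ : ℝ × ℝ} (hφ : φ ∈ quadrant) (r : ℝ≥0∞)
  {S : ℝ → (ℕ → ℝ) → ℝ≥0∞} (hS : Measurable fun z : ℝ × (ℕ → ℝ) => S z.1 z.2)

include hq hφ hS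

lemma integrable_stepCost_seqCost_prod :
    Integrable (fun z : ℝ × (ℕ → ℝ) =>
      stepCost q φ r z.1 (seqCost q n (afterJump q φ z.1) z.2 (S z.1 z.2)))
      ((expMeasure q.mu).prod (waitLaw q.mu)) := by
  have h0 : 0 < q.mu := by linarith [hq.one_lt_mu]
  have hT : Measurable fun w : ℕ → ℝ => if r < ENNReal.ofReal (w 0) then r
      else ENNReal.ofReal (w 0) + S (w 0) (tailSeq w) := by
    have hw0 : Measurable fun w : ℕ → ℝ => ENNReal.ofReal (w 0) :=
      (measurable_pi_apply 0).ennreal_ofReal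
    exact Measurable.ite (measurableSet_lt measurable_const hw0) measurable_const
      (hw0.add (hS.comp ((measurable_pi_apply 0).prodMk measurable_tailSeq)))
  have h1 := integrable_seqCost hq (n + 1) hφ hT
  rw [← map_consSeq_prod_waitLaw h0, integrable_map_measure
    (Measurable.seqCost q (n + 1) measurable_const measurable_id' hT).aestronglyMeasurable
    measurable_consSeq.aemeasurable] at h1
  refine h1.congr (Filter.Eventually.of_forall fun z => ?_)
  simp only [Function.comp]
  rw [seqCost_succ_ite]
  simp

lemma ae_integral_stepCost_seqCost :
    ∀ᵐ x ∂(expMeasure q.mu),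
      ∫ w, stepCost q φ r x (seqCost q n (afterJump q φ x) w (S x w)) ∂(waitLaw q.mu)
        = stepCost q φ r x (∫ w, seqCost q n (afterJump q φ x) w (S x w) ∂(waitLaw q.mu)) := by
  have := isProbabilityMeasure_waitLaw (by linarith [hq.one_lt_mu] : 0 < q.mu)
  filter_upwards [ae_pos_expMeasure] with x hx
  exact integral_stepCost_right _ q φ r x (integrable_seqCost hq n
    (afterJump_mem_quadrant hq hφ hx.le) (hS.comp measurable_prodMk_left))

lemma integrable_stepCost_integral_seqCost :
    Integrable (fun x => stepCost q φ r x
      (∫ w, seqCost q n (afterJump q φ x) w (S x w) ∂(waitLaw q.mu))) (expMeasure q.mu) := by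
  have h0 : 0 < q.mu := by linarith [hq.one_lt_mu]
  have := isProbabilityMeasure_expMeasure h0
  have := isProbabilityMeasure_waitLaw h0
  exact (integrable_stepCost_seqCost_prod hq n hφ r hS).integral_prod_left.congr
    (ae_integral_stepCost_seqCost hq n hφ r hS)

/-- Conditioning on the first waiting time. -/
lemma integral_seqCost_succ :
    ∫ w, seqCost q (n + 1) φ w (if r < ENNReal.ofReal (w 0) then r
        else ENNReal.ofReal (w 0) + S (w 0) (tailSeq w)) ∂(waitLaw q.mu)
      = ∫ x, stepCost q φ r x (∫ w, seqCost q n (afterJump q φ x) w (S x w) ∂(waitLaw q.mu))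
          ∂(expMeasure q.mu) := by
  have h0 : 0 < q.mu := by linarith [hq.one_lt_mu]
  have := isProbabilityMeasure_expMeasure h0
  have := isProbabilityMeasure_waitLaw h0
  simp_rw [seqCost_succ_ite]
  have hm : Measurable fun w : ℕ → ℝ => stepCost q φ r (w 0)
      (seqCost q n (afterJump q φ (w 0)) (tailSeq w) (S (w 0) (tailSeq w))) :=
    Measurable.stepCost q measurable_const measurable_const (measurable_pi_apply 0)
      (Measurable.seqCost q n ((continuous_afterJump q).measurable.comp
        (measurable_const.prodMk (measurable_pi_apply 0))) measurable_tailSeq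
        (hS.comp ((measurable_pi_apply 0).prodMk measurable_tailSeq)))
  conv_lhs => rw [← map_consSeq_prod_waitLaw h0]
  rw [integral_map measurable_consSeq.aemeasurable hm.aestronglyMeasurable]
  simp only [consSeq_zero, tailSeq_consSeq]
  rw [integral_prod _ (integrable_stepCost_seqCost_prod hq n hφ r hS)]
  exact integral_congr_ae (ae_integral_stepCost_seqCost hq n hφ r hS)

end OneStep

/-! ## The single-jump operator in terms of the first waiting time -/

/-- The mean cost of stopping at `s` or at the first jump, with terminal cost `v`. -/
noncomputable def meanStep (q : Params) (v : ℝ × ℝ → ℝ) (s : ℝ≥0∞) (φ : ℝ × ℝ) : ℝ :=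
  ∫ x, stepCost q φ s x (v (afterJump q φ x)) ∂(expMeasure q.mu)

open Classical in
/-- The optimal mean cost over deterministic times, set to `0` outside the quadrant. -/
noncomputable def optStep (q : Params) (v : ℝ × ℝ → ℝ) (φ : ℝ × ℝ) : ℝ :=
  if φ ∈ quadrant then ⨅ s : ℝ≥0∞, meanStep q v s φ else 0

open Classical in
/-- The first positive `ε`-optimal deterministic time, set to `0` outside the quadrant. -/
noncomputable def stepWait (q : Params) (v : ℝ × ℝ → ℝ) (ε : ℝ) (φ : ℝ × ℝ) : ℝ≥0∞ :=
  if φ ∈ quadrant ∧ ∃ s : ℝ≥0∞, 0 < s ∧ meanStep q v s φ ≤ optStep q v φ + ε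
  then sInf {s : ℝ≥0∞ | 0 < s ∧ meanStep q v s φ ≤ optStep q v φ + ε}
  else 0

section Bounded

variable {q : Params} (hq : q.Admissible) {v : ℝ × ℝ → ℝ} (hv : Measurable v) {C : ℝ}
  (hC : ∀ φ, |v φ| ≤ C)

lemma Measurable.stepCost_afterJump {α : Type*} [MeasurableSpace α] (q : Params)
    {v : ℝ × ℝ → ℝ} (hv : Measurable v) {φ : α → ℝ × ℝ} {s : α → ℝ≥0∞} {x : α → ℝ}
    (hφ : Measurable φ) (hs : Measurable s) (hx : Measurable x) :
    Measurable fun a => PoissonDisorder.stepCost q (φ a) (s a) (x a)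
      (v (afterJump q (φ a) (x a))) :=
  Measurable.stepCost q hφ hs hx
    (hv.comp ((continuous_afterJump q).measurable.comp (hφ.prodMk hx)))

include hv in
lemma measurable_meanStep (hq : q.Admissible) (s : ℝ≥0∞) : Measurable (meanStep q v s) := by
  have := isProbabilityMeasure_expMeasure (by linarith [hq.one_lt_mu] : 0 < q.mu)
  exact (StronglyMeasurable.integral_prod_right
    (f := fun (φ : ℝ × ℝ) (x : ℝ) => stepCost q φ s x (v (afterJump q φ x)))
    (Measurable.stepCost_afterJump q hv measurable_fst measurable_const
      measurable_snd).stronglyMeasurable).measurable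

include hq hv hC

lemma integrable_stepCost_afterJump {φ : ℝ × ℝ} (hφ : φ ∈ quadrant) (s : ℝ≥0∞) :
    Integrable (fun x => stepCost q φ s x (v (afterJump q φ x))) (expMeasure q.mu) := by
  have := isProbabilityMeasure_expMeasure (by linarith [hq.one_lt_mu] : 0 < q.mu)
  obtain ⟨A, -, h⟩ := exists_abs_stepCost_le_of_bounded hq
  refine Integrable.mono' (((integrable_exp_expMeasure hq.one_lt_mu).const_mul (A * weight φ)).add
    (integrable_const C)) (Measurable.stepCost_afterJump q hv measurable_const measurable_const
      measurable_id').aestronglyMeasurable ?_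
  filter_upwards [ae_pos_expMeasure] with x hx
  exact h φ hφ s x hx.le _ C (hC _)

omit hq hv hC in
-- For a fixed first jump `x` the terminal term switches on at `s = x`, and this is the only
-- possible discontinuity.
lemma continuousAt_stepCost (q : Params) (φ : ℝ × ℝ) {s : ℝ≥0∞} {x : ℝ} (c : ℝ)
    (hs : ENNReal.ofReal x ≠ s) : ContinuousAt (fun s => stepCost q φ s x c) s := by
  unfold stepCost
  refine ContinuousAt.add ?_ ?_
  · have h1 : Continuous (legCost q φ) :=
      (continuous_legCost q).comp (continuous_const.prodMk continuous_id)
    refine h1.continuousAt.comp ?_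
    have h2 : min s (ENNReal.ofReal x) ≠ ∞ := (min_lt_of_right_lt ENNReal.ofReal_lt_top).ne
    exact (ENNReal.tendsto_toReal h2).comp
      (continuous_id.min continuous_const : Continuous fun s => min s (ENNReal.ofReal x)).continuousAt
  · rcases lt_or_gt_of_ne hs with h | h
    · refine (continuousAt_const (y := Real.exp (-q.lam * x) * c)).congr ?_
      filter_upwards [lt_mem_nhds h] with t ht
      rw [if_pos ht.le]
    · refine (continuousAt_const (y := (0 : ℝ))).congr ?_
      filter_upwards [gt_mem_nhds h] with t ht
      rw [if_neg ht.not_ge]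

/-- The exponential law has no atoms, so the discontinuity at `s = x` is almost surely avoided, and
dominated convergence applies with the bound `e^x`. The point `s = ∞` is included, which makes
compactness of `[0, ∞]` available. -/
lemma continuous_meanStep {φ : ℝ × ℝ} (hφ : φ ∈ quadrant) :
    Continuous fun s : ℝ≥0∞ => meanStep q v s φ := by
  have := isProbabilityMeasure_expMeasure (by linarith [hq.one_lt_mu] : 0 < q.mu)
  obtain ⟨A, -, h⟩ := exists_abs_stepCost_le_of_bounded hq
  rw [continuous_iff_continuousAt]
  intro s
  refine continuousAt_of_dominated (bound := fun x => A * weight φ * Real.exp x + C)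
    (.of_forall fun t => (integrable_stepCost_afterJump hq hv hC hφ t).aestronglyMeasurable)
    (.of_forall fun t => ?_) (((integrable_exp_expMeasure hq.one_lt_mu).const_mul _).add
    (integrable_const C)) ?_
  · filter_upwards [ae_pos_expMeasure] with x hx
    exact h φ hφ t x hx.le _ C (hC _)
  -- At `s = ∞` the excluded point is `s.toReal = 0`, which costs nothing.
  · filter_upwards [ae_pos_expMeasure, ae_ne_expMeasure s.toReal] with x hx hxs
    refine continuousAt_stepCost q φ _ fun hs => hxs ?_
    rw [← hs, ENNReal.toReal_ofReal hx.le]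

lemma meanStep_ge {φ : ℝ × ℝ} (hφ : φ ∈ quadrant) (s : ℝ≥0∞) :
    -(|q.lam / q.c * √2| / q.lam) - C ≤ meanStep q v s φ := by
  have := isProbabilityMeasure_expMeasure (by linarith [hq.one_lt_mu] : 0 < q.mu)
  have h := integral_mono_ae (integrable_const (-(|q.lam / q.c * √2| / q.lam) - C))
    (integrable_stepCost_afterJump hq hv hC hφ s) ?_
  · simpa [meanStep] using h
  · filter_upwards [ae_pos_expMeasure] with x hx
    have h1 := legCost_ge hq hφ (r := (min s (ENNReal.ofReal x)).toReal) ENNReal.toReal_nonneg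
    have hC0 : 0 ≤ C := (abs_nonneg _).trans (hC 0)
    have hl := hq.lam_pos
    have he : Real.exp (-q.lam * x) ≤ 1 := Real.exp_le_one_iff.2 (by nlinarith)
    have he0 := Real.exp_pos (-q.lam * x)
    have h3 := (abs_le.1 (hC (afterJump q φ x))).1
    unfold stepCost
    split_ifs
    · nlinarith
    · linarith

lemma bddBelow_range_meanStep {φ : ℝ × ℝ} (hφ : φ ∈ quadrant) :
    BddBelow (Set.range fun s : ℝ≥0∞ => meanStep q v s φ) :=
  ⟨_, by rintro _ ⟨s, rfl⟩; exact meanStep_ge hq hv hC hφ s⟩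

omit hq hv hC in
lemma meanStep_zero (q : Params) (v : ℝ × ℝ → ℝ) (φ : ℝ × ℝ) : meanStep q v 0 φ = 0 := by
  unfold meanStep
  rw [integral_congr_ae (g := fun _ => (0 : ℝ)), integral_zero]
  filter_upwards [ae_pos_expMeasure] with x hx
  simp [stepCost, legCost, hx]

lemma optStep_le_meanStep {φ : ℝ × ℝ} (hφ : φ ∈ quadrant) (s : ℝ≥0∞) :
    optStep q v φ ≤ meanStep q v s φ := by
  rw [optStep, if_pos hφ]
  exact ciInf_le (bddBelow_range_meanStep hq hv hC hφ) s

/-- Although `g` is unbounded above, stopping at once costs `0` and bounds the infimum from above;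
the lower bound on a leg is uniform in the state. -/
lemma abs_optStep_le (φ : ℝ × ℝ) : |optStep q v φ| ≤ |q.lam / q.c * √2| / q.lam + C := by
  have hC0 : 0 ≤ C := (abs_nonneg _).trans (hC 0)
  have hl := hq.lam_pos
  have h0 : 0 ≤ |q.lam / q.c * √2| / q.lam := by positivity
  by_cases hφ : φ ∈ quadrant
  · rw [abs_le]
    constructor
    · rw [optStep, if_pos hφ]
      refine le_ciInf fun s => ?_
      linarith [meanStep_ge hq hv hC hφ s]
    · have := optStep_le_meanStep hq hv hC hφ 0
      rw [meanStep_zero] at this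
      linarith
  · rw [optStep, if_neg hφ, abs_zero]
    positivity

/-- By continuity in `s` the infimum may be taken over a countable dense set of times. -/
lemma measurable_optStep : Measurable (optStep q v) := by
  classical
  have h : optStep q v = fun φ => if φ ∈ quadrant then
      ⨅ k : ℕ, meanStep q v (TopologicalSpace.denseSeq ℝ≥0∞ k) φ else 0 := by
    ext φ
    unfold optStep
    split_ifs with hφ
    · have hb := bddBelow_range_meanStep hq hv hC hφ
      refine le_antisymm (le_ciInf fun k => ciInf_le hb _) (le_ciInf fun s => ?_)
      have hcl : IsClosed {s : ℝ≥0∞ | ⨅ k : ℕ, meanStep q v (TopologicalSpace.denseSeq ℝ≥0∞ k) φ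
          ≤ meanStep q v s φ} := isClosed_le continuous_const (continuous_meanStep hq hv hC hφ)
      refine (TopologicalSpace.denseRange_denseSeq ℝ≥0∞).induction_on s hcl fun k => ?_
      refine ciInf_le ?_ k
      exact hb.mono (by rintro _ ⟨j, rfl⟩; exact ⟨_, rfl⟩)
    · rfl
  rw [h]
  exact Measurable.ite measurableSet_quadrant
    (Measurable.iInf fun k => measurable_meanStep hv hq _) measurable_const

lemma exists_meanStep_eq_optStep {φ : ℝ × ℝ} (hφ : φ ∈ quadrant) :
    ∃ s, meanStep q v s φ = optStep q v φ := by
  obtain ⟨s, -, hs⟩ := isCompact_univ.exists_isMinOn Set.univ_nonempty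
    (continuous_meanStep hq hv hC hφ).continuousOn
  refine ⟨s, le_antisymm ?_ (optStep_le_meanStep hq hv hC hφ s)⟩
  rw [optStep, if_pos hφ]
  exact le_ciInf fun t => hs (Set.mem_univ t)

/-- The waiting time is `ε`-optimal. -/
lemma meanStep_stepWait_le {φ : ℝ × ℝ} (hφ : φ ∈ quadrant) {ε : ℝ} (hε : 0 ≤ ε) :
    meanStep q v (stepWait q v ε φ) φ ≤ optStep q v φ + ε := by
  unfold stepWait
  split_ifs with h
  · obtain ⟨-, hne⟩ := h
    -- The set of `ε`-optimal times is closed, so it contains the infimum of its positive elements,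
    -- even when that infimum is `0`.
    have hcl : IsClosed {s : ℝ≥0∞ | meanStep q v s φ ≤ optStep q v φ + ε} :=
      isClosed_le (continuous_meanStep hq hv hC hφ) continuous_const
    exact hcl.closure_subset_iff.2 (fun s hs => hs.2) (csInf_mem_closure hne (OrderBot.bddBelow _))
  -- Without a positive `ε`-optimal time, the existing minimiser must be `0`, which is exactly the
  -- default value.
  · obtain ⟨s, hs⟩ := exists_meanStep_eq_optStep hq hv hC hφ
    rcases eq_or_ne s 0 with rfl | h0
    · linarith
    · exact absurd ⟨hφ, s, pos_iff_ne_zero.2 h0, by linarith⟩ h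

omit hq hv hC in
-- The quantifier over uncountably many `s` is replaced by countable ones. Values below every
-- `1/(m+1)` at dense points of one compact interval `[d i, d j]` inside `(0, b)` force the minimum
-- over that interval to be nonpositive. The compact interval keeps the minimiser away from `0` and
-- `b`.
lemma measurableSet_exists_nonpos {α : Type*} [MeasurableSpace α] {h : ℝ≥0∞ → α → ℝ}
    {Q : Set α} (hQ : MeasurableSet Q) (hm : ∀ s, Measurable (h s))
    (hc : ∀ a ∈ Q, Continuous fun s => h s a) (b : ℝ≥0∞) :
    MeasurableSet {a | a ∈ Q ∧ ∃ s, 0 < s ∧ s < b ∧ h s a ≤ 0} := by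
  set d := TopologicalSpace.denseSeq ℝ≥0∞ with hd
  have hdense : DenseRange d := TopologicalSpace.denseRange_denseSeq ℝ≥0∞
  have key : {a | a ∈ Q ∧ ∃ s, 0 < s ∧ s < b ∧ h s a ≤ 0}
      = Q ∩ ⋃ (i : ℕ) (j : ℕ) (_ : 0 < d i ∧ d j < b), ⋂ m : ℕ,
          ⋃ (k : ℕ) (_ : d i < d k ∧ d k < d j), {a | h (d k) a < 1 / ((m : ℝ) + 1)} := by
    ext a
    simp only [Set.mem_ofPred_eq, Set.mem_inter_iff, Set.mem_iUnion, Set.mem_iInter, exists_prop]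
    refine and_congr_right fun ha => ⟨?_, ?_⟩
    · rintro ⟨s, h0, hb, hs⟩
      obtain ⟨i, hi⟩ := hdense.exists_mem_open isOpen_Ioo (exists_between h0)
      obtain ⟨j, hj⟩ := hdense.exists_mem_open isOpen_Ioo (exists_between hb)
      refine ⟨i, j, ⟨hi.1, hj.2⟩, fun m => ?_⟩
      have hm : (0 : ℝ) < 1 / ((m : ℝ) + 1) := by positivity
      obtain ⟨k, hk⟩ := hdense.exists_mem_open
        (isOpen_Ioo.inter (isOpen_lt (hc a ha) (continuous_const (y := 1 / ((m : ℝ) + 1)))))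
        ⟨s, ⟨hi.2, hj.1⟩, lt_of_le_of_lt hs hm⟩
      exact ⟨k, hk.1, hk.2⟩
    · rintro ⟨i, j, ⟨hi, hj⟩, hall⟩
      obtain ⟨k, hk, -⟩ := hall 0
      obtain ⟨s, hs, hmin⟩ := (isCompact_Icc (a := d i) (b := d j)).exists_isMinOn
        ⟨d k, hk.1.le, hk.2.le⟩ (hc a ha).continuousOn
      refine ⟨s, hi.trans_le hs.1, hs.2.trans_lt hj, ?_⟩
      by_contra! hpos
      obtain ⟨m, hm⟩ := exists_nat_one_div_lt hpos
      obtain ⟨k, hk, hlt⟩ := hall m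
      have : h s a ≤ h (d k) a := hmin ⟨hk.1.le, hk.2.le⟩
      linarith
  rw [key]
  refine hQ.inter (.iUnion fun i => .iUnion fun j => .iUnion fun _ => .iInter fun m =>
    .iUnion fun k => .iUnion fun _ => measurableSet_lt (hm _) measurable_const)

lemma measurable_stepWait (ε : ℝ) : Measurable (stepWait q v ε) := by
  set h : ℝ≥0∞ → ℝ × ℝ → ℝ := fun s φ => meanStep q v s φ - (optStep q v φ + ε) with hh
  have hm : ∀ s, Measurable (h s) := fun s =>
    (measurable_meanStep hv hq s).sub ((measurable_optStep hq hv hC).add_const ε)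
  have hE := measurableSet_exists_nonpos measurableSet_quadrant hm
    fun φ hφ => (continuous_meanStep hq hv hC hφ).sub continuous_const
  -- The time `s = ∞` needs a separate term, since the previous sets only see `s < b`.
  have hN : MeasurableSet {φ | φ ∈ quadrant ∧ ∃ s : ℝ≥0∞, 0 < s ∧ h s φ ≤ 0} := by
    have : {φ | φ ∈ quadrant ∧ ∃ s : ℝ≥0∞, 0 < s ∧ h s φ ≤ 0}
        = {φ | φ ∈ quadrant ∧ ∃ s, 0 < s ∧ s < ∞ ∧ h s φ ≤ 0}
          ∪ (quadrant ∩ {φ | h ∞ φ ≤ 0}) := by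
      ext φ
      constructor
      · rintro ⟨hφ, s, h0, hs⟩
        rcases eq_or_ne s ∞ with rfl | hne
        · exact Or.inr ⟨hφ, hs⟩
        · exact Or.inl ⟨hφ, s, h0, hne.lt_top, hs⟩
      · rintro (⟨hφ, s, h0, -, hs⟩ | ⟨hφ, hs⟩)
        · exact ⟨hφ, s, h0, hs⟩
        · exact ⟨hφ, ∞, ENNReal.zero_lt_top, hs⟩
    rw [this]
    exact (hE ∞).union (measurableSet_quadrant.inter (measurableSet_le (hm _) measurable_const))
  have hle : ∀ s φ, h s φ ≤ 0 ↔ meanStep q v s φ ≤ optStep q v φ + ε := fun s φ => sub_nonpos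
  simp only [hle] at hN hE
  refine measurable_of_Iio fun b => ?_
  have : stepWait q v ε ⁻¹' Set.Iio b
      = {φ | φ ∈ quadrant ∧ ∃ s, 0 < s ∧ s < b ∧ meanStep q v s φ ≤ optStep q v φ + ε}
        ∪ ({φ | φ ∈ quadrant ∧ ∃ s, 0 < s ∧ meanStep q v s φ ≤ optStep q v φ + ε}ᶜ
          ∩ {_φ | 0 < b}) := by
    ext φ
    simp only [Set.mem_preimage, Set.mem_Iio, Set.mem_union, Set.mem_inter_iff, Set.mem_compl_iff,
      Set.mem_ofPred_eq]
    unfold stepWait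
    split_ifs with hφ
    · rw [sInf_lt_iff]
      simp only [Set.mem_ofPred_eq, hφ, not_true_eq_false, false_and, or_false, true_and]
      exact ⟨fun ⟨s, ⟨h0, hs⟩, hb⟩ => ⟨s, h0, hb, hs⟩, fun ⟨s, h0, hb, hs⟩ => ⟨s, ⟨h0, hs⟩, hb⟩⟩
    · simp only [hφ, not_false_eq_true, true_and]
      refine ⟨Or.inr, ?_⟩
      rintro (⟨hQ, s, h0, -, hs⟩ | hb)
      · exact absurd ⟨hQ, s, h0, hs⟩ hφ
      · exact hb
  rw [this]
  exact (hE b).union (hN.compl.inter (MeasurableSet.const _))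

end Bounded

/-- The iterates of the single-jump operator, set to `0` outside the quadrant. -/
noncomputable def value (q : Params) : ℕ → ℝ × ℝ → ℝ
  | 0 => fun _ => 0
  | n + 1 => optStep q (value q n)

lemma value_measurable_bounded {q : Params} (hq : q.Admissible) (n : ℕ) :
    Measurable (value q n) ∧ ∃ C, ∀ φ, |value q n φ| ≤ C := by
  induction n with
  | zero => exact ⟨measurable_const, 0, fun φ => by simp [value]⟩
  | succ n ih =>
    obtain ⟨hv, C, hC⟩ := ih
    exact ⟨measurable_optStep hq hv hC, _, abs_optStep_le hq hv hC⟩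

/-! ## Counting paths -/

/-- Nondecreasing right-continuous counting paths that skip no value. -/
structure IsCountingPath (p : CountPath) : Prop where
  mono : Monotone p
  right_continuous : ∀ t, ContinuousWithinAt p (Set.Ici t) t
  unit_jumps : ∀ t k, p 0 ≤ k → k ≤ p t → ∃ s, p s = k

lemma IsPoissonProcess.isCountingPath {Ω : Type*} [MeasurableSpace Ω] {N : ℝ≥0 → Ω → ℕ}
    {rate : ℝ} {P : Measure Ω} (hN : IsPoissonProcess N rate P) (ω : Ω) :
    IsCountingPath (pathOf N ω) :=
  ⟨hN.mono ω, hN.right_continuous ω, fun t k _ hk => hN.unit_jumps ω t k hk⟩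

lemma eq_of_forall_le_coe_iff {a b : ℝ≥0∞} (h : ∀ t : ℝ≥0, a ≤ t ↔ b ≤ t) : a = b := by
  refine le_antisymm ?_ ?_
  · cases b with
    | top => exact le_top
    | coe b => exact (h b).2 le_rfl
  · cases a with
    | top => exact le_top
    | coe a => exact (h a).1 le_rfl

namespace IsCountingPath

variable {p : CountPath} (hp : IsCountingPath p)

include hp

/-- Right-continuity of an integer-valued path makes it constant on some `[t, u)`, so the infimum
defining a jump time cannot be approached only from the right of `t`. -/
lemma jumpTime_le_iff {n : ℕ} {t : ℝ≥0} : jumpTime p n ≤ t ↔ p 0 + n ≤ p t := by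
  refine ⟨fun h => ?_, fun h => iInf₂_le t h⟩
  by_contra! hlt
  have hev : {s | p s = p t} ∈ nhdsWithin t (Set.Ici t) := by
    have := hp.right_continuous t
    rw [ContinuousWithinAt, nhds_discrete, Filter.tendsto_pure] at this
    exact this
  obtain ⟨u, hu, hsub⟩ := mem_nhdsGE_iff_exists_Ico_subset.1 hev
  have h1 : (u : ℝ≥0∞) ≤ jumpTime p n := by
    refine le_iInf₂ fun s hs => ENNReal.coe_le_coe.2 ?_
    by_contra! hsu
    rcases le_total t s with hts | hts
    · have : p s = p t := hsub ⟨hts, hsu⟩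
      omega
    · have := hp.mono hts
      omega
  exact absurd (h1.trans h) (by simpa using hu)

omit hp in
lemma _root_.PoissonDisorder.jumpTime_zero (p : CountPath) : jumpTime p 0 = 0 := by
  refine le_antisymm (iInf₂_le 0 (by simp)) zero_le

omit hp in
lemma _root_.PoissonDisorder.jumpTime_mono (p : CountPath) : Monotone (jumpTime p) := by
  intro m n hmn
  refine le_iInf₂ fun t ht => iInf₂_le t (by omega)

lemma jumpTime_lt_succ {n : ℕ} (h : jumpTime p n ≠ ∞) : jumpTime p n < jumpTime p (n + 1) := by
  by_contra! hle
  lift jumpTime p n to ℝ≥0 using h with t ht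
  have h1 := hp.jumpTime_le_iff.1 hle
  obtain ⟨s, hs⟩ := hp.unit_jumps t (p 0 + n) (by omega) (by omega)
  have h2 : jumpTime p n ≤ s := hp.jumpTime_le_iff.2 hs.ge
  rw [← ht, ENNReal.coe_le_coe] at h2
  have := hp.mono h2
  omega

lemma apply_jumpTime {n : ℕ} (h : jumpTime p n ≠ ∞) : p (jumpTime p n).toNNReal = p 0 + n := by
  have h1 := hp.jumpTime_lt_succ h
  lift jumpTime p n to ℝ≥0 using h with t ht
  rw [ENNReal.toNNReal_coe]
  have h2 := hp.jumpTime_le_iff.1 ht.ge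
  have h3 := mt hp.jumpTime_le_iff.2 h1.not_ge
  omega

lemma apply_eq_add_sub (t : ℝ≥0) : p t = p 0 + (p t - p 0) :=
  (Nat.add_sub_of_le (hp.mono zero_le)).symm

lemma shift (s : ℝ≥0) : IsCountingPath (shift s p) where
  mono := fun a b hab => hp.mono (add_le_add_right hab s)
  right_continuous := fun t => by
    refine (hp.right_continuous (s + t)).comp (by fun_prop) fun u hu => ?_
    exact add_le_add_right (Set.mem_Ici.1 hu) s
  unit_jumps := fun t k h0 hk => by
    obtain ⟨u, hu⟩ := hp.unit_jumps (s + t) k ((hp.mono zero_le).trans h0) hk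
    rcases le_total s u with h | h
    · exact ⟨u - s, by rw [PoissonDisorder.shift, add_tsub_cancel_of_le h, hu]⟩
    · refine ⟨0, le_antisymm h0 ?_⟩
      rw [← hu]
      exact hp.mono (h.trans (by simp))

lemma shift_zero_apply (h : jumpTime p 1 ≠ ∞) :
    PoissonDisorder.shift (jumpTime p 1).toNNReal p 0 = p 0 + 1 := by
  rw [PoissonDisorder.shift, add_zero, hp.apply_jumpTime h]

lemma jumpTime_succ_eq (h : jumpTime p 1 ≠ ∞) (n : ℕ) :
    jumpTime p (n + 1)
      = jumpTime p 1 + jumpTime (PoissonDisorder.shift (jumpTime p 1).toNNReal p) n := by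
  have h0 := hp.shift_zero_apply h
  have hs := hp.shift (jumpTime p 1).toNNReal
  have hmono := jumpTime_mono p (show 1 ≤ n + 1 by omega)
  lift jumpTime p 1 to ℝ≥0 using h with s hs'
  rw [ENNReal.toNNReal_coe] at *
  refine eq_of_forall_le_coe_iff fun t => ?_
  rcases lt_or_ge t s with hts | hts
  · have hts' : (t : ℝ≥0∞) < s := ENNReal.coe_lt_coe.2 hts
    exact iff_of_false (hts'.trans_le hmono).not_ge (hts'.trans_le le_self_add).not_ge
  · obtain ⟨u, rfl⟩ := exists_add_of_le hts
    rw [ENNReal.coe_add, ENNReal.add_le_add_iff_left ENNReal.coe_ne_top, hs.jumpTime_le_iff, h0,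
      ← ENNReal.coe_add, hp.jumpTime_le_iff, PoissonDisorder.shift, add_comm n 1, add_assoc]

/-! ### The statistic along a counting path -/

lemma statistic_of_lt (q : Params) (φ : ℝ × ℝ) {t : ℝ≥0} (h : (t : ℝ≥0∞) < jumpTime p 1) :
    statistic q φ p t = flow q t φ := by
  have h1 := mt hp.jumpTime_le_iff.2 h.not_ge
  have h2 : p t - p 0 = 0 := by omega
  rw [statistic, h2, jumpTime_zero]
  simp [stateAtJump]

omit hp in
lemma _root_.PoissonDisorder.stateAtJump_one (q : Params) (φ : ℝ × ℝ) (p : CountPath) :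
    stateAtJump q φ p 1 = afterJump q φ (jumpTime p 1).toReal := by
  simp [stateAtJump, jumpTime_zero, afterJump]

lemma statistic_jumpTime_one (q : Params) (φ : ℝ × ℝ) (h : jumpTime p 1 ≠ ∞) :
    statistic q φ p (jumpTime p 1).toNNReal = afterJump q φ (jumpTime p 1).toReal := by
  rw [statistic, hp.apply_jumpTime h, Nat.add_sub_cancel_left, stateAtJump_one]
  have : (((jumpTime p 1).toNNReal : ℝ≥0) : ℝ) - (jumpTime p 1).toReal = 0 := sub_self _
  rw [this, flow_zero]

/-- Since `∞` is sent to time `0`, the statistic reads the initial state. This case keeps the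
explicit times measurable for all paths, including stopped ones with finitely many jumps. -/
lemma statistic_jumpTime_one_of_eq_top (q : Params) (φ : ℝ × ℝ) (h : jumpTime p 1 = ∞) :
    statistic q φ p (jumpTime p 1).toNNReal = φ := by
  have : statistic q φ p 0 = flow q (0 : ℝ≥0) φ := hp.statistic_of_lt q φ (by simp [h])
  rw [h, ENNReal.toNNReal_top, this, NNReal.coe_zero, flow_zero]

variable (hf : ∀ n, jumpTime p n ≠ ∞)
include hf

lemma jumpTime_shift_ne_top (n : ℕ) :
    jumpTime (PoissonDisorder.shift (jumpTime p 1).toNNReal p) n ≠ ∞ := by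
  have h := hf (n + 1)
  rw [hp.jumpTime_succ_eq (hf 1)] at h
  exact (ENNReal.add_ne_top.1 h).2

lemma toReal_jumpTime_succ (n : ℕ) :
    (jumpTime p (n + 1)).toReal = (jumpTime p 1).toReal
      + (jumpTime (PoissonDisorder.shift (jumpTime p 1).toNNReal p) n).toReal := by
  rw [hp.jumpTime_succ_eq (hf 1), ENNReal.toReal_add (hf 1) (hp.jumpTime_shift_ne_top hf n)]

lemma stateAtJump_succ (q : Params) (φ : ℝ × ℝ) (n : ℕ) :
    stateAtJump q φ p (n + 1) = stateAtJump q (afterJump q φ (jumpTime p 1).toReal)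
      (PoissonDisorder.shift (jumpTime p 1).toNNReal p) n := by
  induction n with
  | zero => exact stateAtJump_one q φ p
  | succ n ih =>
    rw [stateAtJump, ih, stateAtJump, hp.toReal_jumpTime_succ hf (n + 1),
      hp.toReal_jumpTime_succ hf n, add_sub_add_left_eq_sub]

/-- The Markov property of the statistic at the first jump. -/
lemma statistic_add (q : Params) (φ : ℝ × ℝ) (t : ℝ≥0) :
    statistic q φ p ((jumpTime p 1).toNNReal + t)
      = statistic q (afterJump q φ (jumpTime p 1).toReal)
        (PoissonDisorder.shift (jumpTime p 1).toNNReal p) t := by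
  have hs := hp.shift (jumpTime p 1).toNNReal
  have h0 := hp.shift_zero_apply (hf 1)
  have h1 := hs.mono (zero_le (a := t))
  have h2 : p ((jumpTime p 1).toNNReal + t)
      = PoissonDisorder.shift (jumpTime p 1).toNNReal p t := rfl
  have h3 : p ((jumpTime p 1).toNNReal + t) - p 0
      = (PoissonDisorder.shift (jumpTime p 1).toNNReal p t
        - PoissonDisorder.shift (jumpTime p 1).toNNReal p 0) + 1 := by omega
  rw [statistic, statistic, h3, hp.stateAtJump_succ hf, hp.toReal_jumpTime_succ hf]
  congr 1
  rw [NNReal.coe_add]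
  change (jumpTime p 1).toReal + (t : ℝ) - _ = _
  ring

omit hp hf in
/-- The waiting times of a path. -/
noncomputable def _root_.PoissonDisorder.waits (p : CountPath) : ℕ → ℝ :=
  fun n => (jumpTime p (n + 1) - jumpTime p n).toReal

lemma waits_pos (n : ℕ) : 0 < waits p n := by
  refine ENNReal.toReal_pos (tsub_pos_iff_lt.2 (hp.jumpTime_lt_succ (hf n))).ne' ?_
  exact ENNReal.sub_ne_top (hf _)

omit hp hf in
lemma _root_.PoissonDisorder.waits_zero (p : CountPath) : waits p 0 = (jumpTime p 1).toReal := by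
  simp [waits, jumpTime_zero]

omit hp in
lemma _root_.PoissonDisorder.ofReal_waits_zero : ENNReal.ofReal (waits p 0) = jumpTime p 1 := by
  rw [waits_zero, ENNReal.ofReal_toReal (hf 1)]

lemma tailSeq_waits :
    tailSeq (waits p) = waits (PoissonDisorder.shift (jumpTime p 1).toNNReal p) := by
  ext n
  rw [tailSeq, waits, waits, hp.jumpTime_succ_eq (hf 1) (n + 1), hp.jumpTime_succ_eq (hf 1) n,
    ENNReal.add_sub_add_eq_sub_left (hf 1)]

/-! ### The running cost -/

omit hp hf in
lemma _root_.PoissonDisorder.timesUpTo_eq_Icc {T : ℝ≥0∞} (hT : T ≠ ∞) :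
    timesUpTo T = Set.Icc 0 T.toReal := by
  ext t
  exact and_congr_right fun _ => ENNReal.ofReal_le_iff_le_toReal hT

omit hp hf in
lemma _root_.PoissonDisorder.runCost_eq_intervalIntegral (q : Params) (φ : ℝ × ℝ) (p : CountPath)
    {T : ℝ≥0∞} (hT : T ≠ ∞) :
    runCost q φ p T = ∫ t in (0 : ℝ)..T.toReal, costRate q φ p t := by
  rw [runCost, timesUpTo_eq_Icc hT, integral_Icc_eq_integral_Ioc,
    intervalIntegral.integral_of_le ENNReal.toReal_nonneg]

omit hf in
lemma costRate_of_lt (q : Params) (φ : ℝ × ℝ) {t : ℝ} (h0 : 0 ≤ t)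
    (h : ENNReal.ofReal t < jumpTime p 1) :
    costRate q φ p t = Real.exp (-q.lam * t) * g q (flow q t φ) := by
  rw [costRate, hp.statistic_of_lt q φ h, Real.coe_toNNReal _ h0]

lemma costRate_add (q : Params) (φ : ℝ × ℝ) {t : ℝ} (h0 : 0 ≤ t) :
    costRate q φ p (t + (jumpTime p 1).toReal) = Real.exp (-q.lam * (jumpTime p 1).toReal)
      * costRate q (afterJump q φ (jumpTime p 1).toReal)
        (PoissonDisorder.shift (jumpTime p 1).toNNReal p) t := by
  have h1 : (t + (jumpTime p 1).toReal).toNNReal = (jumpTime p 1).toNNReal + t.toNNReal := by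
    rw [Real.toNNReal_add h0 ENNReal.toReal_nonneg, add_comm]
    congr 1
    exact Real.toNNReal_coe
  rw [costRate, costRate, h1, hp.statistic_add hf, ← mul_assoc, ← Real.exp_add]
  congr 2
  ring

omit hf in
lemma runCost_of_le_jumpTime (q : Params) (φ : ℝ × ℝ) {T : ℝ≥0∞} (hT : T ≠ ∞)
    (h : T ≤ jumpTime p 1) : runCost q φ p T = legCost q φ T.toReal := by
  rw [runCost_eq_intervalIntegral q φ p hT]
  refine intervalIntegral.integral_congr_Ioo_of_le ENNReal.toReal_nonneg fun t ht => ?_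
  refine hp.costRate_of_lt q φ ht.1.le (lt_of_lt_of_le ?_ h)
  rw [ENNReal.ofReal_lt_iff_lt_toReal ht.1.le hT]
  exact ht.2

omit hf in
lemma intervalIntegrable_costRate_first (q : Params) (φ : ℝ × ℝ) (h : jumpTime p 1 ≠ ∞) :
    IntervalIntegrable (costRate q φ p) volume 0 (jumpTime p 1).toReal := by
  refine ((continuous_flow_cost_right q φ).intervalIntegrable 0 _).congr_uIoo fun t ht => ?_
  rw [Set.uIoo_of_le ENNReal.toReal_nonneg] at ht
  refine (hp.costRate_of_lt q φ ht.1.le ?_).symm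
  rw [ENNReal.ofReal_lt_iff_lt_toReal ht.1.le h]
  exact ht.2

lemma intervalIntegrable_costRate (q : Params) (φ : ℝ × ℝ) (n : ℕ) :
    IntervalIntegrable (costRate q φ p) volume 0 (jumpTime p n).toReal := by
  induction n generalizing p φ with
  | zero => simp [jumpTime_zero]
  | succ n ih =>
    refine (hp.intervalIntegrable_costRate_first q φ (hf 1)).trans ?_
    have h1 := ((ih (hp.shift _) (hp.jumpTime_shift_ne_top hf)
      (afterJump q φ (jumpTime p 1).toReal)).const_mul
        (Real.exp (-q.lam * (jumpTime p 1).toReal))).comp_sub_right (jumpTime p 1).toReal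
    rw [zero_add, add_comm, ← hp.toReal_jumpTime_succ hf n] at h1
    refine h1.congr_uIoo fun t ht => ?_
    have h2 := ENNReal.toReal_mono (hf (n + 1)) (jumpTime_mono p (show 1 ≤ n + 1 by omega))
    rw [Set.uIoo_of_le h2] at ht
    have := hp.costRate_add hf q φ (sub_nonneg.2 ht.1.le)
    rw [sub_add_cancel] at this
    exact this.symm

/-- The cap at the `(n+1)`-st jump supplies the integrability needed to split the integral at the
first jump; the second part is then shifted in time. -/
lemma runCost_of_jumpTime_le (q : Params) (φ : ℝ × ℝ) {T : ℝ≥0∞} (n : ℕ)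
    (h : jumpTime p 1 ≤ T) (hT : T ≤ jumpTime p (n + 1)) :
    runCost q φ p T = legCost q φ (jumpTime p 1).toReal
      + Real.exp (-q.lam * (jumpTime p 1).toReal)
        * runCost q (afterJump q φ (jumpTime p 1).toReal)
          (PoissonDisorder.shift (jumpTime p 1).toNNReal p) (T - jumpTime p 1) := by
  have hTt : T ≠ ∞ := ne_top_of_le_ne_top (hf _) hT
  have h1 := ENNReal.toReal_mono hTt h
  have h2 := ENNReal.toReal_mono (hf _) hT
  have hint := hp.intervalIntegrable_costRate hf q φ (n + 1)
  rw [← hp.runCost_of_le_jumpTime q φ (hf 1) le_rfl, runCost_eq_intervalIntegral q φ p hTt,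
    runCost_eq_intervalIntegral q φ p (hf 1), runCost_eq_intervalIntegral _ _ _
      (ENNReal.sub_ne_top hTt), ← intervalIntegral.integral_add_adjacent_intervals
      (hp.intervalIntegrable_costRate_first q φ (hf 1))
      (hint.mono_set (Set.uIcc_subset_uIcc
        (Set.mem_uIcc_of_le ENNReal.toReal_nonneg (h1.trans h2))
        (Set.mem_uIcc_of_le ENNReal.toReal_nonneg h2)))]
  congr 1
  rw [← intervalIntegral.integral_const_mul, ENNReal.toReal_sub_of_le h hTt]
  have h3 : ∫ t in (0 : ℝ)..T.toReal - (jumpTime p 1).toReal,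
        Real.exp (-q.lam * (jumpTime p 1).toReal) * costRate q
          (afterJump q φ (jumpTime p 1).toReal)
          (PoissonDisorder.shift (jumpTime p 1).toNNReal p) t
      = ∫ t in (0 : ℝ)..T.toReal - (jumpTime p 1).toReal,
        costRate q φ p (t + (jumpTime p 1).toReal) := by
    refine intervalIntegral.integral_congr fun t ht => ?_
    rw [Set.uIcc_of_le (sub_nonneg.2 h1)] at ht
    exact (hp.costRate_add hf q φ ht.1).symm
  rw [h3, intervalIntegral.integral_comp_add_right (fun t => costRate q φ p t), zero_add,
    sub_add_cancel]

/-- The running cost is a functional of the waiting times. -/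
lemma runCost_eq_seqCost (q : Params) (φ : ℝ × ℝ) (n : ℕ) (T : ℝ≥0∞) :
    runCost q φ p (min T (jumpTime p n)) = seqCost q n φ (waits p) T := by
  induction n generalizing p φ T with
  | zero =>
    rw [jumpTime_zero, runCost_eq_intervalIntegral q φ p (by simp)]
    simp [seqCost]
  | succ n ih =>
    have hle := jumpTime_mono p (show 1 ≤ n + 1 by omega)
    rw [seqCost, stepCost, ofReal_waits_zero hf]
    split_ifs with h
    · rw [hp.runCost_of_jumpTime_le hf q φ n (le_min h hle) (min_le_right _ _), min_eq_right h,
        waits_zero, hp.tailSeq_waits hf]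
      congr 2
      rw [← ih (hp.shift _) (hp.jumpTime_shift_ne_top hf)]
      congr 1
      -- Subtraction of `σ_1` is monotone, hence commutes with `min`, and turns `σ_{n+1}` into the
      -- `n`-th jump time of the shifted path.
      have hmono : Monotone fun a : ℝ≥0∞ => a - jumpTime p 1 := fun a b hab => tsub_le_tsub_right hab _
      rw [hmono.map_min, hp.jumpTime_succ_eq (hf 1) n, ENNReal.add_sub_cancel_left (hf 1)]
    · rw [not_le] at h
      rw [min_eq_left (h.le.trans hle), min_eq_left h.le, add_zero,
        hp.runCost_of_le_jumpTime q φ h.ne_top h.le]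

end IsCountingPath

/-! ## Stopping rules as functionals of the waiting times -/

lemma consSeq_tailSeq (w : ℕ → ℝ) : consSeq (w 0) (tailSeq w) = w := by
  ext n
  cases n <;> rfl

/-- The `ε`-optimal stopping times as functionals of the waiting times. -/
noncomputable def seqEps (q : Params) : ℕ → ℝ → ℝ × ℝ → (ℕ → ℝ) → ℝ≥0∞
  | 0, _, _, _ => 0
  | 1, ε, φ, w => min (stepWait q (value q 0) ε φ) (ENNReal.ofReal (w 0))
  | n + 2, ε, φ, w =>
      if stepWait q (value q (n + 1)) (ε / 2) φ < ENNReal.ofReal (w 0)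
      then stepWait q (value q (n + 1)) (ε / 2) φ
      else ENNReal.ofReal (w 0) + seqEps q (n + 1) (ε / 2) (afterJump q φ (w 0)) (tailSeq w)

/-- The time obtained by waiting at most `ρ k` after the `k`-th jump, for `k < n`, and stopping at
the first waiting time that is not interrupted, or at the `n`-th jump. -/
noncomputable def stopAt : ℕ → (ℕ → ℝ≥0∞) → (ℕ → ℝ) → ℝ≥0∞
  | 0, _, _ => 0
  | n + 1, ρ, w => if ρ 0 < ENNReal.ofReal (w 0) then ρ 0
      else ENNReal.ofReal (w 0) + stopAt n (fun k => ρ (k + 1)) (tailSeq w)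

/-- Rules `ρ k` that depend only on the first `k` waiting times. -/
structure IsNonanticipating (ρ : ℕ → (ℕ → ℝ) → ℝ≥0∞) : Prop where
  measurable : ∀ k, Measurable (ρ k)
  congr : ∀ k w w', (∀ i < k, w i = w' i) → ρ k w = ρ k w'

lemma IsNonanticipating.consSeq {ρ : ℕ → (ℕ → ℝ) → ℝ≥0∞} (h : IsNonanticipating ρ) (x : ℝ) :
    IsNonanticipating fun k w => ρ (k + 1) (consSeq x w) where
  measurable := fun k => (h.measurable (k + 1)).comp (measurable_consSeq.comp measurable_prodMk_left)
  congr := fun k w w' hw => h.congr _ _ _ fun i hi => by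
    cases i with
    | zero => rfl
    | succ i => exact hw i (by omega)

lemma Measurable.stopAt {α : Type*} [MeasurableSpace α] (n : ℕ) {ρ : ℕ → α → ℝ≥0∞}
    {w : α → ℕ → ℝ} (hρ : ∀ k, Measurable (ρ k)) (hw : Measurable w) :
    Measurable fun a => stopAt n (fun k => ρ k a) (w a) := by
  induction n generalizing ρ w with
  | zero => exact measurable_const
  | succ n ih =>
    have h0 : Measurable fun a => ENNReal.ofReal (w a 0) :=
      ((measurable_pi_apply 0).comp hw).ennreal_ofReal
    exact Measurable.ite (measurableSet_lt (hρ 0) h0) (hρ 0)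
      (h0.add (ih (fun k => hρ (k + 1)) (measurable_tailSeq.comp hw)))

/-- The discount factor is at most one, so an error in the continuation is not amplified. -/
lemma stepCost_add_le {q : Params} (hq : q.Admissible) (φ : ℝ × ℝ) (s : ℝ≥0∞) {x : ℝ} (hx : 0 ≤ x)
    (c : ℝ) {d : ℝ} (hd : 0 ≤ d) : stepCost q φ s x (c + d) ≤ stepCost q φ s x c + d := by
  have hl := hq.lam_pos
  have he : Real.exp (-q.lam * x) ≤ 1 := Real.exp_le_one_iff.2 (by nlinarith)
  unfold stepCost
  split_ifs
  · nlinarith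
  · linarith

/-! ### Dynamic programming for rules on waiting times -/

section Optimality

variable {q : Params} (hq : q.Admissible)

include hq

lemma value_le_meanStep (n : ℕ) {φ : ℝ × ℝ} (hφ : φ ∈ quadrant) (s : ℝ≥0∞) :
    value q (n + 1) φ ≤ meanStep q (value q n) s φ := by
  obtain ⟨hv, C, hC⟩ := value_measurable_bounded hq n
  exact optStep_le_meanStep hq hv hC hφ s

lemma meanStep_stepWait_value_le (n : ℕ) {φ : ℝ × ℝ} (hφ : φ ∈ quadrant) {ε : ℝ} (hε : 0 ≤ ε) :
    meanStep q (value q n) (stepWait q (value q n) ε φ) φ ≤ value q (n + 1) φ + ε := by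
  obtain ⟨hv, C, hC⟩ := value_measurable_bounded hq n
  exact meanStep_stepWait_le hq hv hC hφ hε

lemma measurable_stepWait_value (n : ℕ) (ε : ℝ) : Measurable (stepWait q (value q n) ε) := by
  obtain ⟨hv, C, hC⟩ := value_measurable_bounded hq n
  exact measurable_stepWait hq hv hC ε

lemma integrable_stepCost_value (n : ℕ) {φ : ℝ × ℝ} (hφ : φ ∈ quadrant) (s : ℝ≥0∞) :
    Integrable (fun x => stepCost q φ s x (value q n (afterJump q φ x))) (expMeasure q.mu) := by
  obtain ⟨hv, C, hC⟩ := value_measurable_bounded hq n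
  exact integrable_stepCost_afterJump hq hv hC hφ s

/-- No nonanticipating stopping rule does better than the value. -/
lemma value_le_integral_seqCost_stopAt (n : ℕ) {φ : ℝ × ℝ} (hφ : φ ∈ quadrant)
    {ρ : ℕ → (ℕ → ℝ) → ℝ≥0∞} (hρ : IsNonanticipating ρ) :
    value q n φ ≤ ∫ w, seqCost q n φ w (stopAt n (fun k => ρ k w) w) ∂(waitLaw q.mu) := by
  induction n generalizing φ ρ with
  | zero => simp [value, seqCost]
  | succ n ih =>
    -- The first rule may look at no waiting time, so it is constant and can be evaluated at the
    -- zero sequence.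
    set r := ρ 0 0 with hr
    set S : ℝ → (ℕ → ℝ) → ℝ≥0∞ := fun x w => stopAt n (fun k => ρ (k + 1) (consSeq x w)) w with hS
    have hSm : Measurable fun z : ℝ × (ℕ → ℝ) => S z.1 z.2 :=
      Measurable.stopAt n (fun k => (hρ.measurable (k + 1)).comp measurable_consSeq) measurable_snd
    have h1 : ∀ w, stopAt (n + 1) (fun k => ρ k w) w = if r < ENNReal.ofReal (w 0) then r
        else ENNReal.ofReal (w 0) + S (w 0) (tailSeq w) := fun w => by
      rw [stopAt, hρ.congr 0 w 0 (by simp), hS]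
      simp only [consSeq_tailSeq, ← hr]
    simp_rw [h1]
    rw [integral_seqCost_succ hq n hφ r hSm]
    refine (value_le_meanStep hq n hφ r).trans ?_
    refine integral_mono_ae (integrable_stepCost_value hq n hφ r)
      (integrable_stepCost_integral_seqCost hq n hφ r hSm) ?_
    filter_upwards [ae_pos_expMeasure] with x hx
    exact stepCost_mono q φ r x (ih (afterJump_mem_quadrant hq hφ hx.le) (hρ.consSeq x))

lemma Measurable.seqEps {α : Type*} [MeasurableSpace α] (n : ℕ) (ε : ℝ)
    {φ : α → ℝ × ℝ} {w : α → ℕ → ℝ} (hφ : Measurable φ) (hw : Measurable w) :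
    Measurable fun a => seqEps q n ε (φ a) (w a) := by
  have h0 : Measurable fun a => w a 0 := (measurable_pi_apply 0).comp hw
  match n with
  | 0 => exact measurable_const
  | 1 => exact ((measurable_stepWait_value hq 0 ε).comp hφ).min h0.ennreal_ofReal
  | n + 2 =>
    have hr : Measurable fun a => stepWait q (value q (n + 1)) (ε / 2) (φ a) :=
      (measurable_stepWait_value hq (n + 1) (ε / 2)).comp hφ
    exact Measurable.ite (measurableSet_lt hr h0.ennreal_ofReal) hr
      (h0.ennreal_ofReal.add (Measurable.seqEps (n + 1) (ε / 2)
        ((continuous_afterJump q).measurable.comp (hφ.prodMk h0)) (measurable_tailSeq.comp hw)))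

/-- The explicit stopping rule is `ε`-optimal. -/
lemma integral_seqCost_seqEps_le (n : ℕ) {ε : ℝ} (hε : 0 ≤ ε) {φ : ℝ × ℝ} (hφ : φ ∈ quadrant) :
    ∫ w, seqCost q (n + 1) φ w (seqEps q (n + 1) ε φ w) ∂(waitLaw q.mu)
      ≤ value q (n + 1) φ + ε := by
  have h0 : 0 < q.mu := by linarith [hq.one_lt_mu]
  induction n generalizing ε φ with
  | zero =>
    -- The minimum with the first jump is put in the two-branch form, with zero continuation.
    have h1 : ∀ w : ℕ → ℝ, seqEps q 1 ε φ w
        = if stepWait q (value q 0) ε φ < ENNReal.ofReal (w 0) then stepWait q (value q 0) ε φ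
          else ENNReal.ofReal (w 0) + (fun (_ : ℝ) (_ : ℕ → ℝ) => (0 : ℝ≥0∞)) (w 0) (tailSeq w) :=
      fun w => by
        rw [seqEps]
        split_ifs with h
        · exact min_eq_left h.le
        · rw [min_eq_right (not_lt.1 h), add_zero]
    simp_rw [zero_add, h1]
    rw [integral_seqCost_succ hq 0 hφ _ (S := fun _ _ => 0) measurable_const]
    refine le_trans (le_of_eq ?_) (meanStep_stepWait_value_le hq 0 hφ hε)
    simp [meanStep, seqCost, value]
  | succ n ih =>
    have hε2 : 0 ≤ ε / 2 := by positivity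
    have := isProbabilityMeasure_expMeasure h0
    set r := stepWait q (value q (n + 1)) (ε / 2) φ with hr
    set S : ℝ → (ℕ → ℝ) → ℝ≥0∞ := fun x w => seqEps q (n + 1) (ε / 2) (afterJump q φ x) w with hS
    have hSm : Measurable fun z : ℝ × (ℕ → ℝ) => S z.1 z.2 :=
      Measurable.seqEps hq (n + 1) (ε / 2)
        ((continuous_afterJump q).measurable.comp (measurable_const.prodMk measurable_fst))
        measurable_snd
    have h1 : ∀ w : ℕ → ℝ, seqEps q (n + 1 + 1) ε φ w = if r < ENNReal.ofReal (w 0) then r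
        else ENNReal.ofReal (w 0) + S (w 0) (tailSeq w) := fun w => rfl
    simp_rw [h1]
    rw [integral_seqCost_succ hq (n + 1) hφ r hSm]
    have hint := integrable_stepCost_value hq (n + 1) hφ r
    have h2 : ∫ x, stepCost q φ r x (∫ w, seqCost q (n + 1) (afterJump q φ x) w (S x w)
          ∂(waitLaw q.mu)) ∂(expMeasure q.mu)
        ≤ ∫ x, (stepCost q φ r x (value q (n + 1) (afterJump q φ x)) + ε / 2)
          ∂(expMeasure q.mu) := by
      refine integral_mono_ae (integrable_stepCost_integral_seqCost hq (n + 1) hφ r hSm)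
        (hint.add (integrable_const _)) ?_
      filter_upwards [ae_pos_expMeasure] with x hx
      exact (stepCost_mono q φ r x (ih hε2 (afterJump_mem_quadrant hq hφ hx.le))).trans
        (stepCost_add_le hq φ r hx.le _ hε2)
    refine h2.trans ?_
    rw [integral_add hint (integrable_const _)]
    have h3 : meanStep q (value q (n + 1)) r φ ≤ value q (n + 1 + 1) φ + ε / 2 :=
      meanStep_stepWait_value_le hq (n + 1) hφ hε2
    simp only [integral_const, probReal_univ, one_smul]
    unfold meanStep at h3
    linarith

end Optimality

/-- A time that coincides with `ρ k` between the `k`-th and the next jump, if it comes after the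
`k`-th jump, costs the same as the stopping rule given by `ρ`. -/
lemma seqCost_eq_seqCost_stopAt (q : Params) (n : ℕ) (φ : ℝ × ℝ) {w : ℕ → ℝ} (hw : ∀ i, 0 < w i)
    {T : ℝ≥0∞} {ρ : ℕ → ℝ≥0∞}
    (h : ∀ k, ENNReal.ofReal (∑ i ∈ Finset.range k, w i) ≤ T →
      min T (ENNReal.ofReal (∑ i ∈ Finset.range (k + 1), w i))
        = min (ρ k) (ENNReal.ofReal (∑ i ∈ Finset.range (k + 1), w i))) :
    seqCost q n φ w T
      = seqCost q n φ w
        (stopAt n (fun k => ρ k - ENNReal.ofReal (∑ i ∈ Finset.range k, w i)) w) := by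
  induction n generalizing φ w T ρ with
  | zero => rfl
  | succ n ih =>
    have h0 : min T (ENNReal.ofReal (w 0)) = min (ρ 0) (ENNReal.ofReal (w 0)) := by
      simpa using h 0 (by simp)
    have hsum : ∀ k, ENNReal.ofReal (∑ i ∈ Finset.range (k + 1), w i) = ENNReal.ofReal (w 0)
        + ENNReal.ofReal (∑ i ∈ Finset.range k, tailSeq w i) := fun k => by
      have hnn : 0 ≤ ∑ i ∈ Finset.range k, tailSeq w i :=
        Finset.sum_nonneg fun i _ => (hw (i + 1)).le
      rw [← ENNReal.ofReal_add (hw 0).le hnn, Finset.sum_range_succ', add_comm]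
      rfl
    rw [stopAt, seqCost_succ_ite]
    simp only [Finset.range_zero, Finset.sum_empty, ENNReal.ofReal_zero, tsub_zero]
    rw [seqCost, stepCost, stepCost, h0]
    -- Equality of the minima means that `T` and `ρ 0` either both reach the first jump or stop at
    -- the same time before it.
    have hiff : ENNReal.ofReal (w 0) ≤ T ↔ ENNReal.ofReal (w 0) ≤ ρ 0 := by
      rw [← min_eq_right_iff, h0, min_eq_right_iff]
    by_cases hT : ENNReal.ofReal (w 0) ≤ T
    · rw [if_pos hT, if_pos (hiff.1 hT)]
      congr 2
      simp_rw [hsum, ← tsub_tsub]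
      -- The clock restarts at the first jump: `T` becomes `T - w 0` and the rules become `ρ (k + 1)
      -- - w 0`.
      refine ih _ (w := tailSeq w) (fun i => hw _) fun k hk => ?_
      have hmono : Monotone fun a : ℝ≥0∞ => a - ENNReal.ofReal (w 0) :=
        fun a b hab => tsub_le_tsub_right hab _
      have h1 := h (k + 1) (by
        rw [hsum]
        calc _ ≤ ENNReal.ofReal (w 0) + (T - ENNReal.ofReal (w 0)) := by gcongr
          _ = T := add_tsub_cancel_of_le hT)
      rw [hsum (k + 1)] at h1
      have h2 := congrArg (fun a : ℝ≥0∞ => a - ENNReal.ofReal (w 0)) h1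
      rwa [hmono.map_min, hmono.map_min, ENNReal.add_sub_cancel_left ENNReal.ofReal_ne_top] at h2
    · rw [if_neg hT, if_neg (mt hiff.2 hT)]

/-! ## Transfer to the Poisson process -/

lemma measurable_jumpTime {α : Type*} [MeasurableSpace α] {X : α → CountPath}
    (hX : ∀ t, Measurable fun a => X a t) (hp : ∀ a, IsCountingPath (X a)) (n : ℕ) :
    Measurable fun a => jumpTime (X a) n := by
  refine measurable_of_Iic fun b => ?_
  cases b with
  | top => simp
  | coe b =>
    have : (fun a => jumpTime (X a) n) ⁻¹' Set.Iic (b : ℝ≥0∞) = {a | X a 0 + n ≤ X a b} := by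
      ext a
      exact (hp a).jumpTime_le_iff
    rw [this]
    exact measurableSet_le ((hX 0).add_const n) (hX b)

lemma measurable_waits {α : Type*} [MeasurableSpace α] {X : α → CountPath}
    (hX : ∀ t, Measurable fun a => X a t) (hp : ∀ a, IsCountingPath (X a)) :
    Measurable fun a => waits (X a) :=
  measurable_pi_iff.2 fun n =>
    ((measurable_jumpTime hX hp (n + 1)).sub (measurable_jumpTime hX hp n)).ennreal_toReal

section Poisson

variable {Ω : Type*} [MeasurableSpace Ω] {P : Measure Ω} {N : ℝ≥0 → Ω → ℕ} {rate : ℝ}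
  (hN : IsPoissonProcess N rate P)

include hN

lemma IsPoissonProcess.measurable_jumpTime (n : ℕ) :
    Measurable fun ω => jumpTime (pathOf N ω) n :=
  PoissonDisorder.measurable_jumpTime (X := pathOf N) hN.measurable hN.isCountingPath n

lemma IsPoissonProcess.measurable_waits : Measurable fun ω => waits (pathOf N ω) :=
  PoissonDisorder.measurable_waits (X := pathOf N) hN.measurable hN.isCountingPath

lemma IsPoissonProcess.ae_jumpTime_ne_top : ∀ᵐ ω ∂P, ∀ n, jumpTime (pathOf N ω) n ≠ ∞ := by
  have h : ∀ᵐ ω ∂P, ∀ n, jumpTime (pathOf N ω) (n + 1) - jumpTime (pathOf N ω) n ≠ ∞ := by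
    rw [ae_all_iff]
    intro n
    have hm : Measurable fun ω => jumpTime (pathOf N ω) (n + 1) - jumpTime (pathOf N ω) n :=
      (hN.measurable_jumpTime (n + 1)).sub (hN.measurable_jumpTime n)
    refine ae_of_ae_map (p := fun y => y ≠ ∞) hm.aemeasurable ?_
    rw [hN.law_waiting n, ae_map_iff (p := fun y => y ≠ ∞) ENNReal.measurable_ofReal.aemeasurable
      (measurableSet_singleton _).compl]
    exact .of_forall fun x => ENNReal.ofReal_ne_top
  filter_upwards [h] with ω hω n
  induction n with
  | zero => simp [jumpTime_zero]
  | succ n ih =>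
    intro htop
    exact hω n (by rw [htop]; exact ENNReal.top_sub ih)

lemma IsPoissonProcess.map_waits_apply (n : ℕ) :
    P.map (fun ω => waits (pathOf N ω) n) = expMeasure rate := by
  have hm : Measurable fun ω => jumpTime (pathOf N ω) (n + 1) - jumpTime (pathOf N ω) n :=
    (hN.measurable_jumpTime (n + 1)).sub (hN.measurable_jumpTime n)
  have h1 := congrArg (Measure.map ENNReal.toReal) (hN.law_waiting n)
  rw [Measure.map_map ENNReal.measurable_toReal hm,
    Measure.map_map ENNReal.measurable_toReal ENNReal.measurable_ofReal] at h1
  have h2 : (expMeasure rate).map (ENNReal.toReal ∘ ENNReal.ofReal) = expMeasure rate := by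
    conv_rhs => rw [← Measure.map_id (μ := expMeasure rate)]
    refine Measure.map_congr ?_
    filter_upwards [ae_pos_expMeasure] with x hx
    exact ENNReal.toReal_ofReal hx.le
  rw [← h2, ← h1]
  rfl

lemma IsPoissonProcess.map_waits :
    P.map (fun ω => waits (pathOf N ω)) = waitLaw rate := by
  have h1 := hN.indep_waiting.comp (fun _ => ENNReal.toReal) fun _ => ENNReal.measurable_toReal
  have h2 := iIndepFun.map_fun_eq_infinitePi_map
    (fun n => (measurable_pi_apply n).comp hN.measurable_waits) h1
  have h3 : waitLaw rate
      = Measure.infinitePi fun n => P.map fun ω => waits (pathOf N ω) n := by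
    rw [waitLaw]
    exact congrArg Measure.infinitePi (funext fun n => (hN.map_waits_apply n).symm)
  rw [h3]
  exact h2

end Poisson

section Transfer

variable {Ω : Type*} [MeasurableSpace Ω] {P : Measure Ω}
  {N : ℝ≥0 → Ω → ℕ} {q : Params} (hq : q.Admissible) (hN : IsPoissonProcess N q.mu P)

lemma singleJumpCost_eq_stepCost (q : Params) (v : ℝ × ℝ → ℝ) (t : ℝ≥0∞) (φ : ℝ × ℝ)
    {p : CountPath} (hp : IsCountingPath p) (hf : ∀ n, jumpTime p n ≠ ∞) :
    singleJumpCost q v t φ p = stepCost q φ t (waits p 0) (v (afterJump q φ (waits p 0))) := by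
  rw [singleJumpCost, stepCost, ofReal_waits_zero hf, waits_zero,
    hp.runCost_of_le_jumpTime q φ (ne_top_of_le_ne_top (hf 1) (min_le_right _ _)) (min_le_right _ _),
    hp.statistic_jumpTime_one q φ (hf 1)]

include hq hN

lemma ae_singleJumpCost_eq {v v' : ℝ × ℝ → ℝ} (hv : ∀ φ ∈ quadrant, v φ = v' φ) (t : ℝ≥0∞)
    {φ : ℝ × ℝ} (hφ : φ ∈ quadrant) :
    (fun ω => singleJumpCost q v t φ (pathOf N ω)) =ᵐ[P]
      fun ω => stepCost q φ t (waits (pathOf N ω) 0)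
        (v' (afterJump q φ (waits (pathOf N ω) 0))) := by
  filter_upwards [hN.ae_jumpTime_ne_top] with ω hω
  rw [singleJumpCost_eq_stepCost q v t φ (hN.isCountingPath ω) hω,
    hv _ (afterJump_mem_quadrant hq hφ ((hN.isCountingPath ω).waits_pos hω 0).le)]

/-- Agreement on the quadrant suffices because post-jump states stay there. So the iterates may be
replaced by `value`, which is measurable and bounded on the whole plane. -/
lemma opJ_eq_meanStep {v v' : ℝ × ℝ → ℝ} (hv' : Measurable v')
    (hv : ∀ φ ∈ quadrant, v φ = v' φ) (t : ℝ≥0∞) {φ : ℝ × ℝ} (hφ : φ ∈ quadrant) :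
    opJ q P N v t φ = meanStep q v' t φ := by
  rw [opJ, integral_congr_ae (ae_singleJumpCost_eq hq hN hv t hφ), meanStep,
    ← hN.map_waits_apply 0, integral_map]
  · exact ((measurable_pi_apply 0).comp hN.measurable_waits).aemeasurable
  · exact (Measurable.stepCost_afterJump q hv' measurable_const measurable_const
      measurable_id').aestronglyMeasurable

lemma iterate_eq_value (n : ℕ) : ∀ φ ∈ quadrant, iterate q P N n φ = value q n φ := by
  induction n with
  | zero => exact fun φ _ => rfl
  | succ n ih =>
    intro φ hφ
    rw [iterate, opJ₀, value, optStep, if_pos hφ]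
    exact iInf_congr fun t => opJ_eq_meanStep hq hN (value_measurable_bounded hq n).1 ih t hφ

lemma opJ_iterate_eq (n : ℕ) (t : ℝ≥0∞) {φ : ℝ × ℝ} (hφ : φ ∈ quadrant) :
    opJ q P N (iterate q P N n) t φ = meanStep q (value q n) t φ :=
  opJ_eq_meanStep hq hN (value_measurable_bounded hq n).1 (iterate_eq_value hq hN n) t hφ

lemma integrable_singleJumpCost_iterate (n : ℕ) (t : ℝ≥0∞) {φ : ℝ × ℝ} (hφ : φ ∈ quadrant) :
    Integrable (fun ω => singleJumpCost q (iterate q P N n) t φ (pathOf N ω)) P := by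
  rw [integrable_congr (ae_singleJumpCost_eq hq hN (iterate_eq_value hq hN n) t hφ)]
  have h := integrable_stepCost_value hq n hφ t
  rw [← hN.map_waits_apply 0] at h
  exact h.comp_measurable ((measurable_pi_apply 0).comp hN.measurable_waits)

lemma waitTime_eq_stepWait (n : ℕ) (ε : ℝ) {φ : ℝ × ℝ} (hφ : φ ∈ quadrant) :
    waitTime q P N n ε φ = stepWait q (value q n) ε φ := by
  have h0 : opJ₀ q P N (iterate q P N n) φ = optStep q (value q n) φ := by
    rw [opJ₀, optStep, if_pos hφ]
    exact iInf_congr fun t => opJ_iterate_eq hq hN n t hφ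
  have h1 : ∀ s, (0 < s ∧ opJ q P N (iterate q P N n) s φ
      ≤ opJ₀ q P N (iterate q P N n) φ + ε) ↔
      (0 < s ∧ meanStep q (value q n) s φ ≤ optStep q (value q n) φ + ε) := fun s => by
    rw [opJ_iterate_eq hq hN n s hφ, h0]
  have h2 := exists_congr h1
  rw [waitTime, stepWait]
  by_cases h : ∃ s, 0 < s ∧ meanStep q (value q n) s φ ≤ optStep q (value q n) φ + ε
  · rw [if_pos (h2.2 h), if_pos ⟨hφ, h⟩]
    simp only [h1]
  · rw [if_neg (mt h2.1 h), if_neg fun h' => h h'.2]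

lemma epsTime_eq_seqEps (n : ℕ) (ε : ℝ) {φ : ℝ × ℝ} (hφ : φ ∈ quadrant) {p : CountPath}
    (hp : IsCountingPath p) (hf : ∀ n, jumpTime p n ≠ ∞) :
    epsTime q P N n ε φ p = seqEps q n ε φ (waits p) := by
  match n with
  | 0 => rfl
  | 1 => rw [epsTime, seqEps, waitTime_eq_stepWait hq hN 0 ε hφ, ofReal_waits_zero hf]
  | n + 2 =>
    rw [epsTime, seqEps, waitTime_eq_stepWait hq hN (n + 1) (ε / 2) hφ, ofReal_waits_zero hf,
      hp.statistic_jumpTime_one q φ (hf 1), hp.tailSeq_waits hf, waits_zero,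
      epsTime_eq_seqEps (n + 1) (ε / 2) (afterJump_mem_quadrant hq hφ ENNReal.toReal_nonneg)
        (hp.shift _) (hp.jumpTime_shift_ne_top hf)]

omit hq hN in
lemma epsTime_le_jumpTime (q : Params) (P : Measure Ω) (N : ℝ≥0 → Ω → ℕ) (n : ℕ) (ε : ℝ)
    (φ : ℝ × ℝ) {p : CountPath} (hp : IsCountingPath p) (hf : ∀ n, jumpTime p n ≠ ∞) :
    epsTime q P N n ε φ p ≤ jumpTime p n := by
  match n with
  | 0 => exact zero_le
  | 1 => exact min_le_right _ _
  | n + 2 =>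
    rw [epsTime]
    split_ifs with h
    · exact h.le.trans (jumpTime_mono p (by omega))
    · rw [hp.jumpTime_succ_eq (hf 1) (n + 1)]
      gcongr
      exact epsTime_le_jumpTime q P N (n + 1) (ε / 2) _ (hp.shift _) (hp.jumpTime_shift_ne_top hf)

omit hq in
lemma ae_runCost_min_eq (n : ℕ) (φ : ℝ × ℝ) (τ : Ω → ℝ≥0∞) :
    (fun ω => runCost q φ (pathOf N ω) (min (τ ω) (jumpTime (pathOf N ω) n))) =ᵐ[P]
      fun ω => seqCost q n φ (waits (pathOf N ω)) (τ ω) := by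
  filter_upwards [hN.ae_jumpTime_ne_top] with ω hω
  exact (hN.isCountingPath ω).runCost_eq_seqCost hω q φ n (τ ω)

/-- Truncated costs are integrable, with a mean that is bounded uniformly in the time. -/
lemma exists_integrable_runCost_bound (n : ℕ) {φ : ℝ × ℝ} (hφ : φ ∈ quadrant) :
    ∃ C : ℝ, ∀ τ : Ω → ℝ≥0∞, Measurable τ →
      Integrable (fun ω => runCost q φ (pathOf N ω) (min (τ ω) (jumpTime (pathOf N ω) n))) P ∧
      -C ≤ ∫ ω, runCost q φ (pathOf N ω) (min (τ ω) (jumpTime (pathOf N ω) n)) ∂P := by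
  obtain ⟨K, -, hK⟩ := exists_abs_seqCost_le hq n
  have hb : Integrable (fun ω => K * weight φ * expSum n (waits (pathOf N ω))) P := by
    have h := (integrable_expSum hq.one_lt_mu n).const_mul (K * weight φ)
    rw [← hN.map_waits] at h
    exact h.comp_measurable hN.measurable_waits
  refine ⟨∫ ω, K * weight φ * expSum n (waits (pathOf N ω)) ∂P, fun τ hτ => ?_⟩
  have hle : ∀ᵐ ω ∂P, |seqCost q n φ (waits (pathOf N ω)) (τ ω)|
      ≤ K * weight φ * expSum n (waits (pathOf N ω)) := by
    filter_upwards [hN.ae_jumpTime_ne_top] with ω hω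
    exact hK φ hφ _ ((hN.isCountingPath ω).waits_pos hω) _
  have hint : Integrable (fun ω => seqCost q n φ (waits (pathOf N ω)) (τ ω)) P :=
    hb.mono' (Measurable.seqCost q n measurable_const hN.measurable_waits hτ).aestronglyMeasurable hle
  refine ⟨(integrable_congr (ae_runCost_min_eq hN n φ τ)).2 hint, ?_⟩
  rw [integral_congr_ae (ae_runCost_min_eq hN n φ τ), ← integral_neg]
  refine integral_mono_ae hb.neg hint ?_
  filter_upwards [hle] with ω hω
  exact (abs_le.1 hω).1

lemma integral_runCost_epsTime_le (n : ℕ) {ε : ℝ} (hε : 0 ≤ ε) {φ : ℝ × ℝ} (hφ : φ ∈ quadrant) :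
    ∫ ω, runCost q φ (pathOf N ω) (min (epsTime q P N (n + 1) ε φ (pathOf N ω))
      (jumpTime (pathOf N ω) (n + 1))) ∂P ≤ value q (n + 1) φ + ε := by
  refine le_trans (le_of_eq ?_) (integral_seqCost_seqEps_le hq n hε hφ)
  rw [integral_congr_ae (ae_runCost_min_eq hN (n + 1) φ _), ← hN.map_waits, integral_map
    hN.measurable_waits.aemeasurable (Measurable.seqCost q (n + 1) measurable_const measurable_id'
      (Measurable.seqEps hq (n + 1) ε measurable_const measurable_id')).aestronglyMeasurable]
  refine integral_congr_ae ?_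
  filter_upwards [hN.ae_jumpTime_ne_top] with ω hω
  rw [epsTime_eq_seqEps hq hN (n + 1) ε hφ (hN.isCountingPath ω) hω]

end Transfer

/-! ## Stopping times of the Poisson filtration between jumps -/

section Filtration

variable {Ω : Type*} [mΩ : MeasurableSpace Ω] {P : Measure Ω} {N : ℝ≥0 → Ω → ℕ}

/-- The strict inequality removes the right limit: each `{τ ≤ r}` with rational `r < t` lies in the
right-continuous σ-algebra at `r`, hence in the completed one at `t`. -/
lemma measurableSet_completedFiltration_lt {τ : Ω → ℝ≥0∞}
    (hτ : IsStoppingTime (obsFiltration N P) τ) (t : ℝ≥0) :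
    MeasurableSet[completedFiltration N P t] {ω | τ ω < t} := by
  have h : {ω | τ ω < t} = ⋃ (r : ℚ) (_ : Real.toNNReal r < t),
      {ω | τ ω ≤ (Real.toNNReal r : ℝ≥0)} := by
    ext ω
    simp only [Set.mem_ofPred_eq, Set.mem_iUnion, exists_prop]
    constructor
    · intro hω
      obtain ⟨r, -, h1, h2⟩ := ENNReal.lt_iff_exists_rat_btwn.1 hω
      exact ⟨r, ENNReal.coe_lt_coe.1 h2, h1.le⟩
    · rintro ⟨r, h1, h2⟩
      exact h2.trans_lt (ENNReal.coe_lt_coe.2 h1)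
  rw [h]
  refine MeasurableSet.iUnion fun r => MeasurableSet.iUnion fun hr => ?_
  have h1 := hτ (Real.toNNReal r)
  rw [obsFiltration, Filtration.rightCont_eq] at h1
  exact (iInf₂_le t hr : (⨅ j > Real.toNNReal r, completedFiltration N P j) ≤ _) _ h1

lemma exists_ae_eq_of_measurableSet_completedFiltration {t : ℝ≥0} {A : Set Ω}
    (hA : MeasurableSet[completedFiltration N P t] A) :
    ∃ B : Set (Set.Iic t → ℕ), MeasurableSet B ∧
      ∀ᵐ ω ∂P, ω ∈ A ↔ (fun s : Set.Iic t => N s ω) ∈ B := by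
  obtain ⟨B, hB, hAB⟩ := (MeasurableSpace.measurableSet_inf.1 hA).2
  have h : (⨆ s : Set.Iic t, MeasurableSpace.comap (N s) (inferInstance : MeasurableSpace ℕ))
      = MeasurableSpace.comap (fun ω (s : Set.Iic t) => N s ω) MeasurableSpace.pi := by
    rw [MeasurableSpace.pi, MeasurableSpace.comap_iSup]
    simp only [MeasurableSpace.comap_comp]
    rfl
  rw [h] at hB
  obtain ⟨C, hC, rfl⟩ := hB
  refine ⟨C, hC, ?_⟩
  filter_upwards [hAB] with ω hω
  exact iff_of_eq hω

end Filtration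

/-! ### Reading a stopping time off the waiting times -/

open Classical in
/-- The path that jumps at the first `k` times given by the waiting times `w`. -/
noncomputable def jumpsPath (k : ℕ) (w : ℕ → ℝ) (s : ℝ≥0) : ℕ :=
  ∑ j ∈ Finset.range k, if ENNReal.ofReal (∑ i ∈ Finset.range (j + 1), w i) ≤ s then 1 else 0

open Classical in
/-- The first time after the `k`-th jump at which the events `B t` have occurred, when no further
jump occurs. -/
noncomputable def stopRule (B : ∀ t : ℝ≥0, Set (Set.Iic t → ℕ)) (k : ℕ) (w : ℕ → ℝ) : ℝ≥0∞ :=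
  ⨅ r : ℚ, if ENNReal.ofReal (∑ i ∈ Finset.range k, w i) < (Real.toNNReal r : ℝ≥0)
      ∧ (fun s : Set.Iic (Real.toNNReal r) => jumpsPath k w s) ∈ B (Real.toNNReal r)
    then ((Real.toNNReal r : ℝ≥0) : ℝ≥0∞) else ∞

lemma measurable_ofReal_sum_range (k : ℕ) :
    Measurable fun w : ℕ → ℝ => ENNReal.ofReal (∑ i ∈ Finset.range k, w i) :=
  (Finset.measurable_sum _ fun i _ => measurable_pi_apply i).ennreal_ofReal

lemma measurable_jumpsPath (k : ℕ) (s : ℝ≥0) : Measurable fun w => jumpsPath k w s := by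
  unfold jumpsPath
  exact Finset.measurable_sum _ fun j _ => Measurable.ite
    (measurableSet_le (measurable_ofReal_sum_range _) measurable_const)
    measurable_const measurable_const

lemma measurable_stopRule {B : ∀ t : ℝ≥0, Set (Set.Iic t → ℕ)} (hB : ∀ t, MeasurableSet (B t))
    (k : ℕ) : Measurable (stopRule B k) := by
  unfold stopRule
  refine Measurable.iInf fun r => Measurable.ite ?_ measurable_const measurable_const
  have h : Measurable fun w => (fun s : Set.Iic (Real.toNNReal r) => jumpsPath k w s) :=
    measurable_pi_iff.2 fun s => measurable_jumpsPath k s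
  exact (measurableSet_lt (measurable_ofReal_sum_range k) measurable_const).inter (h (hB _))

/-- Only partial sums of at most `k` waiting times enter the rule. The difference with the `k`-th
jump time converts an absolute time into a wait. -/
lemma isNonanticipating_stopRule {B : ∀ t : ℝ≥0, Set (Set.Iic t → ℕ)}
    (hB : ∀ t, MeasurableSet (B t)) :
    IsNonanticipating fun k w =>
      stopRule B k w - ENNReal.ofReal (∑ i ∈ Finset.range k, w i) where
  measurable := fun k => (measurable_stopRule hB k).sub (measurable_ofReal_sum_range k)
  congr := fun k w w' h => by
    have h1 : ∀ j ≤ k, ∑ i ∈ Finset.range j, w i = ∑ i ∈ Finset.range j, w' i := fun j hj =>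
      Finset.sum_congr rfl fun i hi => h i ((Finset.mem_range.1 hi).trans_le hj)
    have h2 : jumpsPath k w = jumpsPath k w' := by
      ext s
      unfold jumpsPath
      refine Finset.sum_congr rfl fun j hj => ?_
      rw [h1 _ (Finset.mem_range.1 hj)]
    unfold stopRule
    rw [h1 k le_rfl, h2]

namespace IsCountingPath

variable {p : CountPath} (hp : IsCountingPath p) (hf : ∀ n, jumpTime p n ≠ ∞)

include hp hf

lemma ofReal_sum_waits (n : ℕ) :
    ENNReal.ofReal (∑ i ∈ Finset.range n, waits p i) = jumpTime p n := by
  induction n with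
  | zero => simp [jumpTime_zero]
  | succ n ih =>
    rw [Finset.sum_range_succ, ENNReal.ofReal_add (Finset.sum_nonneg fun i _ =>
      (hp.waits_pos hf i).le) (hp.waits_pos hf n).le, ih, waits,
      ENNReal.ofReal_toReal (ENNReal.sub_ne_top (hf _)),
      add_tsub_cancel_of_le (hp.jumpTime_lt_succ (hf n)).le]

lemma eq_jumpsPath (h0 : p 0 = 0) {s t : ℝ≥0} (hst : s ≤ t) :
    p s = jumpsPath (p t) (waits p) s := by
  have hle := hp.mono hst
  have h1 : ∀ j, jumpTime p (j + 1) ≤ s ↔ j < p s := fun j => by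
    rw [hp.jumpTime_le_iff]; omega
  unfold jumpsPath
  simp only [hp.ofReal_sum_waits hf, h1]
  rw [Finset.sum_boole, Nat.cast_id]
  have : Finset.filter (fun j => j < p s) (Finset.range (p t)) = Finset.range (p s) := by
    ext j
    simp only [Finset.mem_filter, Finset.mem_range]
    omega
  rw [this, Finset.card_range]

/-- Between jumps, a stopping time is given by a rule that depends on the past jumps only. -/
lemma min_eq_min_stopRule (h0 : p 0 = 0) {T : ℝ≥0∞} {B : ∀ t : ℝ≥0, Set (Set.Iic t → ℕ)}
    (hT : ∀ r : ℚ, T < (Real.toNNReal r : ℝ≥0) ↔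
      (fun s : Set.Iic (Real.toNNReal r) => p s) ∈ B (Real.toNNReal r))
    {k : ℕ} (hk : jumpTime p k ≤ T) :
    min T (jumpTime p (k + 1)) = min (stopRule B k (waits p)) (jumpTime p (k + 1)) := by
  -- Strictly between two jumps the true path up to `r` is the one rebuilt from the first `k` waits,
  -- so both pass or both fail the test `B`.
  have key : ∀ r : ℚ, jumpTime p k < (Real.toNNReal r : ℝ≥0) →
      ((Real.toNNReal r : ℝ≥0) : ℝ≥0∞) < jumpTime p (k + 1) →
      (T < (Real.toNNReal r : ℝ≥0) ↔
        (fun s : Set.Iic (Real.toNNReal r) => jumpsPath k (waits p) s) ∈ B (Real.toNNReal r)) := by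
    intro r h1 h2
    have h3 := hp.jumpTime_le_iff.1 h1.le
    have h4 := mt hp.jumpTime_le_iff.2 h2.not_ge
    have h5 : p (Real.toNNReal r) = k := by omega
    have h6 : (fun s : Set.Iic (Real.toNNReal r) => p s)
        = fun s : Set.Iic (Real.toNNReal r) => jumpsPath k (waits p) s := by
      ext s
      rw [hp.eq_jumpsPath hf h0 s.2, h5]
    rw [hT r, h6]
  refine le_antisymm (le_min ?_ (min_le_right _ _)) (le_min ?_ (min_le_right _ _))
  · unfold stopRule
    refine le_iInf fun r => ?_
    split_ifs with h
    -- Rationals past the next jump may be accepted wrongly, as the rebuilt path then misses a jump;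
    -- the cap by `σ_{k+1}` makes them harmless.
    · rw [hp.ofReal_sum_waits hf] at h
      rcases lt_or_ge ((Real.toNNReal r : ℝ≥0) : ℝ≥0∞) (jumpTime p (k + 1)) with h2 | h2
      · exact (min_le_left _ _).trans ((key r h.1 h2).2 h.2).le
      · exact (min_le_right _ _).trans h2
    · exact le_top
  · rcases le_or_gt (jumpTime p (k + 1)) T with h | h
    · exact (min_le_right _ _).trans h
    -- When `T` comes before the next jump, rationals just above `T` are accepted; `σ_k ≤ T` puts
    -- them after the `k`-th jump.
    · refine (min_le_left _ _).trans (le_of_forall_gt fun b hb => ?_)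
      obtain ⟨r, -, h1, h2⟩ := ENNReal.lt_iff_exists_rat_btwn.1 (lt_min hb h)
      obtain ⟨h2, h3⟩ := lt_min_iff.1 h2
      refine lt_of_le_of_lt (iInf_le _ r) ?_
      rw [hp.ofReal_sum_waits hf, if_pos ⟨hk.trans_lt h1, (key r (hk.trans_lt h1) h3).1 h1⟩]
      exact h2

end IsCountingPath

/-- No stopping time does better than the value. -/
lemma value_le_integral_runCost {Ω : Type*} [MeasurableSpace Ω] {P : Measure Ω}
    {N : ℝ≥0 → Ω → ℕ} {q : Params} (hq : q.Admissible) (hN : IsPoissonProcess N q.mu P) (n : ℕ)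
    {φ : ℝ × ℝ} (hφ : φ ∈ quadrant) {τ : Ω → ℝ≥0∞} (hτ : IsStoppingTime (obsFiltration N P) τ) :
    value q n φ
      ≤ ∫ ω, runCost q φ (pathOf N ω) (min (τ ω) (jumpTime (pathOf N ω) n)) ∂P := by
  choose B hB hτB using fun t : ℝ≥0 =>
    exists_ae_eq_of_measurableSet_completedFiltration (measurableSet_completedFiltration_lt hτ t)
  have hρ := isNonanticipating_stopRule hB
  -- The rule tests rational times only, so countably many null sets are discarded.
  have hall : ∀ᵐ ω ∂P, ∀ r : ℚ, τ ω < (Real.toNNReal r : ℝ≥0) ↔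
      (fun s : Set.Iic (Real.toNNReal r) => N s ω) ∈ B (Real.toNNReal r) :=
    ae_all_iff.2 fun r => hτB (Real.toNNReal r)
  refine (value_le_integral_seqCost_stopAt hq n hφ hρ).trans (le_of_eq ?_)
  rw [integral_congr_ae (ae_runCost_min_eq hN n φ τ), ← hN.map_waits, integral_map
    hN.measurable_waits.aemeasurable (Measurable.seqCost q n measurable_const measurable_id'
      (Measurable.stopAt n hρ.measurable measurable_id')).aestronglyMeasurable]
  refine integral_congr_ae ?_
  filter_upwards [hN.ae_jumpTime_ne_top, hall] with ω hf hω
  have hp := hN.isCountingPath ω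
  refine (seqCost_eq_seqCost_stopAt q n φ (hp.waits_pos hf) fun k hk => ?_).symm
  rw [hp.ofReal_sum_waits hf] at hk ⊢
  exact hp.min_eq_min_stopRule hf (hN.start ω) hω hk

/-! ## The explicit times are stopping times -/

/-- The increment up to the random time is at least `n` exactly when the `n`-th jump has occurred by
then, which avoids joint measurability in time and path. -/
lemma measurable_apply_time {α : Type*} [MeasurableSpace α] {X : α → CountPath}
    (hX : ∀ t, Measurable fun a => X a t) (hp : ∀ a, IsCountingPath (X a)) {T : α → ℝ≥0}
    (hT : Measurable T) : Measurable fun a => X a (T a) := by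
  have h : Measurable fun a => X a (T a) - X a 0 := by
    refine measurable_of_Ici fun n => ?_
    have : (fun a => X a (T a) - X a 0) ⁻¹' Set.Ici n = {a | jumpTime (X a) n ≤ T a} := by
      ext a
      have := (hp a).mono (zero_le (a := T a))
      simp only [Set.mem_preimage, Set.mem_Ici, Set.mem_ofPred_eq]
      rw [(hp a).jumpTime_le_iff]
      omega
    rw [this]
    exact measurableSet_le (measurable_jumpTime hX hp n) hT.coe_nnreal_ennreal
  have h2 : (fun a => X a (T a)) = fun a => X a 0 + (X a (T a) - X a 0) :=
    funext fun a => (hp a).apply_eq_add_sub (T a)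
  rw [h2]
  exact (hX 0).add h

lemma IsCountingPath.statistic_mem_quadrant {q : Params} (hq : q.Admissible) {p : CountPath}
    (hp : IsCountingPath p) {φ : ℝ × ℝ} (hφ : φ ∈ quadrant) :
    statistic q φ p (jumpTime p 1).toNNReal ∈ quadrant := by
  by_cases h : jumpTime p 1 = ∞
  · rwa [hp.statistic_jumpTime_one_of_eq_top q φ h]
  · rw [hp.statistic_jumpTime_one q φ h]
    exact afterJump_mem_quadrant hq hφ ENNReal.toReal_nonneg

lemma measurable_statistic_jumpTime_one {α : Type*} [MeasurableSpace α] (q : Params)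
    {X : α → CountPath} (hX : ∀ t, Measurable fun a => X a t) (hp : ∀ a, IsCountingPath (X a))
    {φ : α → ℝ × ℝ} (hφ : Measurable φ) :
    Measurable fun a => statistic q (φ a) (X a) (jumpTime (X a) 1).toNNReal := by
  classical
  have hj := measurable_jumpTime hX hp 1
  have h : (fun a => statistic q (φ a) (X a) (jumpTime (X a) 1).toNNReal)
      = fun a => if jumpTime (X a) 1 = ∞ then φ a
        else afterJump q (φ a) (jumpTime (X a) 1).toReal := by
    ext1 a
    split_ifs with h
    · exact (hp a).statistic_jumpTime_one_of_eq_top q (φ a) h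
    · exact (hp a).statistic_jumpTime_one q (φ a) h
  rw [h]
  exact Measurable.ite (hj (measurableSet_singleton ∞)) hφ
    ((continuous_afterJump q).measurable.comp (hφ.prodMk hj.ennreal_toReal))

/-- The path stopped at time `t`. -/
def stopPath (t : ℝ≥0) (p : CountPath) : CountPath := fun s => p (min s t)

lemma IsCountingPath.stopPath {p : CountPath} (hp : IsCountingPath p) (t : ℝ≥0) :
    IsCountingPath (stopPath t p) where
  mono := fun a b hab => hp.mono (min_le_min_right t hab)
  right_continuous := fun s => by
    refine (hp.right_continuous (min s t)).comp (t := Set.Ici (min s t))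
      (f := fun u : ℝ≥0 => min u t) (by fun_prop) fun u hu => ?_
    exact min_le_min_right t (Set.mem_Ici.1 hu)
  unit_jumps := fun s k h0 hk => by
    obtain ⟨u, hu⟩ := hp.unit_jumps (min s t) k ((hp.mono zero_le).trans h0) hk
    rcases le_total u t with h | h
    · exact ⟨u, by rw [PoissonDisorder.stopPath, min_eq_left h, hu]⟩
    · refine ⟨s, le_antisymm ?_ hk⟩
      rw [← hu]
      exact hp.mono ((min_le_right _ _).trans h)

lemma IsCountingPath.jumpTime_congr {p p' : CountPath} (hp : IsCountingPath p)
    (hp' : IsCountingPath p') {t : ℝ≥0} (h : ∀ s ≤ t, p s = p' s) {n : ℕ}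
    (hn : jumpTime p n ≤ t) : jumpTime p' n = jumpTime p n := by
  have hn' : jumpTime p' n ≤ t := by
    rwa [hp'.jumpTime_le_iff, ← h 0 zero_le, ← h t le_rfl, ← hp.jumpTime_le_iff]
  refine eq_of_forall_le_coe_iff fun u => ?_
  rcases le_total u t with hu | hu
  · rw [hp'.jumpTime_le_iff, ← h 0 zero_le, ← h u hu, ← hp.jumpTime_le_iff]
  · have hu' : (t : ℝ≥0∞) ≤ u := ENNReal.coe_le_coe.2 hu
    exact iff_of_true (hn'.trans hu') (hn.trans hu')

/-- The σ-algebra generated by the process up to time `t`. -/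
abbrev pastSpace {Ω : Type*} (N : ℝ≥0 → Ω → ℕ) (t : ℝ≥0) : MeasurableSpace Ω :=
  ⨆ s : Set.Iic t, MeasurableSpace.comap (N s) inferInstance

section EpsTime

variable {Ω : Type*} [mΩ : MeasurableSpace Ω] {P : Measure Ω} {N : ℝ≥0 → Ω → ℕ} {q : Params}

/-- Whether the explicit time comes before `t` is decided by the path up to time `t`. -/
lemma epsTime_congr (n : ℕ) (ε : ℝ) (φ : ℝ × ℝ) {p p' : CountPath}
    (hp : IsCountingPath p) (hp' : IsCountingPath p') {t : ℝ≥0} (h : ∀ s ≤ t, p s = p' s)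
    (hle : epsTime q P N n ε φ p ≤ t) : epsTime q P N n ε φ p' = epsTime q P N n ε φ p := by
  -- A jump of `p'` by time `r ≤ t` would also be a jump of `p`, as the paths agree up to `t`.
  have hlt : ∀ r : ℝ≥0∞, r ≤ t → r < jumpTime p 1 → r < jumpTime p' 1 := fun r hrt hr => by
    by_contra! hr'
    have := hp'.jumpTime_congr hp (fun s hs => (h s hs).symm) (hr'.trans hrt)
    exact hr.not_ge (this ▸ hr')
  match n with
  | 0 => rfl
  | 1 =>
    rw [epsTime] at hle
    rw [epsTime, epsTime]
    rcases lt_or_ge (waitTime q P N 0 ε φ) (jumpTime p 1) with h1 | h1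
    · rw [min_eq_left h1.le] at hle ⊢
      exact min_eq_left (hlt _ hle h1).le
    · rw [min_eq_right h1] at hle
      rw [hp.jumpTime_congr hp' h hle]
  | n + 2 =>
    rw [epsTime] at hle
    rw [epsTime, epsTime]
    split_ifs at hle with h1
    · rw [if_pos h1, if_pos (hlt _ hle h1)]
    · have h2 : jumpTime p 1 ≤ t := le_self_add.trans hle
      have h3 : jumpTime p 1 ≠ ∞ := ne_top_of_le_ne_top ENNReal.coe_ne_top h2
      have h4 := hp.jumpTime_congr hp' h h2
      have h5 : statistic q φ p' (jumpTime p' 1).toNNReal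
          = statistic q φ p (jumpTime p 1).toNNReal := by
        rw [hp.statistic_jumpTime_one q φ h3, hp'.statistic_jumpTime_one q φ (h4 ▸ h3), h4]
      rw [if_neg h1, h5, h4, if_neg h1]
      congr 1
      set s := (jumpTime p 1).toNNReal with hs
      have h6 : s ≤ t := ENNReal.toNNReal_mono ENNReal.coe_ne_top h2
      -- The shifted paths agree on the remaining horizon `t - s`, to which the recursion applies.
      refine epsTime_congr (n + 1) (ε / 2) _ (hp.shift s) (hp'.shift s) (t := t - s)
        (fun u hu => h _ ?_) ?_
      · calc s + u ≤ s + (t - s) := by gcongr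
          _ = t := add_tsub_cancel_of_le h6
      · rw [ENNReal.coe_sub, hs, ENNReal.coe_toNNReal h3]
        exact ENNReal.le_sub_of_add_le_left h3 hle

variable (hq : q.Admissible) (hN : IsPoissonProcess N q.mu P)

include hq hN

/-- Stated for any measurable space and every counting path, without finiteness of the jump times,
so that it applies to stopped paths and the σ-algebra of the past. -/
lemma measurable_epsTime {α : Type*} [mα : MeasurableSpace α] (n : ℕ) (ε : ℝ) {X : α → CountPath}
    (hX : ∀ t, Measurable fun a => X a t) (hp : ∀ a, IsCountingPath (X a))
    {φ : α → ℝ × ℝ} (hφ : Measurable φ) (hφq : ∀ a, φ a ∈ quadrant) :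
    Measurable fun a => epsTime q P N n ε (φ a) (X a) := by
  have hj := measurable_jumpTime hX hp 1
  have hr : ∀ k δ, Measurable fun a => waitTime q P N k δ (φ a) := fun k δ => by
    simp_rw [fun a => waitTime_eq_stepWait hq hN k δ (hφq a)]
    exact (measurable_stepWait_value hq k δ).comp hφ
  match n with
  | 0 => exact measurable_const
  | 1 => exact (hr 0 ε).min hj
  | n + 2 =>
    refine Measurable.ite (measurableSet_lt (hr (n + 1) (ε / 2)) hj) (hr (n + 1) (ε / 2))
      (hj.add (measurable_epsTime (n + 1) (ε / 2) (fun t => ?_) (fun a => (hp a).shift _)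
        (measurable_statistic_jumpTime_one q hX hp hφ)
        fun a => (hp a).statistic_mem_quadrant hq (hφq a)))
    exact measurable_apply_time hX hp (hj.ennreal_toNNReal.add_const t)

/-- The path stopped at `t` is measurable for the past at `t`, and it gives the same answer to
whether the time is at most `t`. -/
lemma isStoppingTime_epsTime (n : ℕ) (ε : ℝ) {φ : ℝ × ℝ} (hφ : φ ∈ quadrant) :
    IsStoppingTime (obsFiltration N P) fun ω => epsTime q P N n ε φ (pathOf N ω) := by
  intro t
  have hp := hN.isCountingPath
  have hmΩ : pastSpace N t ≤ mΩ := iSup_le fun s => (hN.measurable s).comap_le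
  have hX : ∀ s, Measurable[pastSpace N t] fun ω => stopPath t (pathOf N ω) s := fun s => by
    rw [measurable_iff_comap_le]
    exact le_iSup (fun s : Set.Iic t => MeasurableSpace.comap (N s) inferInstance)
      ⟨min s t, Set.mem_Iic.2 (min_le_right s t)⟩
  have hmeas : Measurable[pastSpace N t] fun ω => epsTime q P N n ε φ (stopPath t (pathOf N ω)) :=
    measurable_epsTime (mα := pastSpace N t) hq hN n ε hX (fun ω => (hp ω).stopPath t) measurable_const
      fun _ => hφ
  have hset : {ω | epsTime q P N n ε φ (pathOf N ω) ≤ t}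
      = {ω | epsTime q P N n ε φ (stopPath t (pathOf N ω)) ≤ t} := by
    ext ω
    have h : ∀ s ≤ t, pathOf N ω s = stopPath t (pathOf N ω) s := fun s hs => by
      rw [stopPath, min_eq_left hs]
    constructor
    · intro hω
      exact (epsTime_congr n ε φ (hp ω) ((hp ω).stopPath t) h hω).trans_le hω
    · intro hω
      exact (epsTime_congr n ε φ ((hp ω).stopPath t) (hp ω) (fun s hs => (h s hs).symm) hω).trans_le
        hω
  have h1 : MeasurableSet[pastSpace N t] {ω | epsTime q P N n ε φ (pathOf N ω) ≤ t} := by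
    rw [hset]
    exact hmeas measurableSet_Iic
  have h2 : MeasurableSet[completedFiltration N P t] {ω | epsTime q P N n ε φ (pathOf N ω) ≤ t} :=
    MeasurableSpace.measurableSet_inf.2 ⟨hmΩ _ h1, le_eventuallyMeasurableSpace _ h1⟩
  exact (completedFiltration N P).le_rightCont t _ h2

end EpsTime

end PoissonDisorder

/-! ### Assembly of the claims -/

theorem proposition5p5 {Ω : Type*} [MeasurableSpace Ω] (P : Measure Ω) [IsProbabilityMeasure P]
    (q : Params) (hlam : 0 < q.lam) (hmu : 1 < q.mu) (hc : 0 < q.c)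
    (hm : q.m ∈ Set.Ioo (-1 : ℝ) 1)
    (N : ℝ≥0 → Ω → ℕ) (hN : IsPoissonProcess N q.mu P) :
    -- all quantities involved are well defined and finite
    (∀ n : ℕ,
      Measurable (fun φ : quadrant => iterate q P N n φ) ∧
      (∃ C : ℝ, ∀ φ ∈ quadrant, |iterate q P N n φ| ≤ C) ∧
      ∀ φ ∈ quadrant,
        (∀ᵐ ω ∂P, IntegrableOn (costRate q φ (pathOf N ω))
          (timesUpTo (jumpTime (pathOf N ω) n))) ∧
        (∀ τ : Ω → ℝ≥0∞, IsStoppingTime (obsFiltration N P) τ →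
          Integrable (fun ω => runCost q φ (pathOf N ω)
            (min (τ ω) (jumpTime (pathOf N ω) n))) P) ∧
        BddBelow (truncatedCosts q P N n φ) ∧
        (∀ t : ℝ≥0∞, Integrable
          (fun ω => singleJumpCost q (iterate q P N n) t φ (pathOf N ω)) P) ∧
        BddBelow (Set.range fun t : ℝ≥0∞ => opJ q P N (iterate q P N n) t φ)) ∧
    -- the iterates are the truncated value functions
    (∀ n : ℕ, 1 ≤ n → ∀ φ ∈ quadrant, iterate q P N n φ = truncatedValue q P N n φ) ∧
    -- the explicit stopping times are ε-optimal
    (∀ n : ℕ, 1 ≤ n → ∀ ε : ℝ, 0 ≤ ε → ∀ φ ∈ quadrant,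
      IsStoppingTime (obsFiltration N P) (fun ω => epsTime q P N n ε φ (pathOf N ω)) ∧
      (∀ᵐ ω ∂P, epsTime q P N n ε φ (pathOf N ω) ≤ jumpTime (pathOf N ω) n) ∧
      Integrable (fun ω => runCost q φ (pathOf N ω) (epsTime q P N n ε φ (pathOf N ω))) P ∧
      ∫ ω, runCost q φ (pathOf N ω) (epsTime q P N n ε φ (pathOf N ω)) ∂P
        ≤ iterate q P N n φ + ε) := by
  have hq : q.Admissible := ⟨hlam, hmu, hm⟩
  have hmeas : ∀ τ : Ω → ℝ≥0∞, IsStoppingTime (obsFiltration N P) τ → Measurable τ :=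
    fun τ hτ => hτ.measurable'
  have hge : ∀ n : ℕ, ∀ φ ∈ quadrant, ∀ r ∈ truncatedCosts q P N n φ, value q n φ ≤ r := by
    rintro n φ hφ r ⟨τ, hτ, rfl⟩
    exact value_le_integral_runCost hq hN n hφ hτ
  -- The explicit times never exceed `σ_n` almost surely, so the truncation in the definition of the
  -- costs changes nothing.
  have hmin : ∀ n ε φ, (fun ω => runCost q φ (pathOf N ω) (epsTime q P N n ε φ (pathOf N ω)))
      =ᵐ[P] fun ω => runCost q φ (pathOf N ω)
        (min (epsTime q P N n ε φ (pathOf N ω)) (jumpTime (pathOf N ω) n)) := fun n ε φ => by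
    filter_upwards [hN.ae_jumpTime_ne_top] with ω hω
    rw [min_eq_left (epsTime_le_jumpTime q P N n ε φ (hN.isCountingPath ω) hω)]
  refine ⟨fun n => ⟨?_, ?_, fun φ hφ => ⟨?_, fun τ hτ => ?_, ?_, fun t => ?_, ?_⟩⟩, ?_, ?_⟩
  · have h : (fun φ : quadrant => iterate q P N n φ) = fun φ : quadrant => value q n φ :=
      funext fun φ => iterate_eq_value hq hN n φ φ.2
    rw [h]
    exact (value_measurable_bounded hq n).1.comp measurable_subtype_coe
  · obtain ⟨C, hC⟩ := (value_measurable_bounded hq n).2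
    exact ⟨C, fun φ hφ => by rw [iterate_eq_value hq hN n φ hφ]; exact hC φ⟩
  · filter_upwards [hN.ae_jumpTime_ne_top] with ω hω
    rw [timesUpTo_eq_Icc (hω n), ← intervalIntegrable_iff_integrableOn_Icc_of_le
      ENNReal.toReal_nonneg]
    exact (hN.isCountingPath ω).intervalIntegrable_costRate hω q φ n
  · obtain ⟨C, hC⟩ := exists_integrable_runCost_bound hq hN n hφ
    exact (hC τ (hmeas τ hτ)).1
  · exact ⟨value q n φ, hge n φ hφ⟩
  · exact integrable_singleJumpCost_iterate hq hN n t hφ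
  · obtain ⟨hv, C, hC⟩ := value_measurable_bounded hq n
    simp_rw [opJ_iterate_eq hq hN n _ hφ]
    exact bddBelow_range_meanStep hq hv hC hφ
  · intro n hn φ hφ
    obtain ⟨n, rfl⟩ := Nat.exists_eq_add_of_le' hn
    -- The rule with `ε = 0` is admissible and costs at most the value, so it attains the infimum
    -- and closes the two-sided estimate.
    have hmem : ∫ ω, runCost q φ (pathOf N ω) (min (epsTime q P N (n + 1) 0 φ (pathOf N ω))
        (jumpTime (pathOf N ω) (n + 1))) ∂P ∈ truncatedCosts q P N (n + 1) φ :=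
      ⟨_, isStoppingTime_epsTime hq hN (n + 1) 0 hφ, rfl⟩
    rw [iterate_eq_value hq hN (n + 1) φ hφ]
    refine le_antisymm (le_csInf ⟨_, hmem⟩ (hge _ φ hφ)) ?_
    refine (csInf_le ⟨_, hge _ φ hφ⟩ hmem).trans ?_
    simpa using integral_runCost_epsTime_le hq hN n le_rfl hφ
  · intro n hn ε hε φ hφ
    obtain ⟨n, rfl⟩ := Nat.exists_eq_add_of_le' hn
    have hst := isStoppingTime_epsTime hq hN (n + 1) ε hφ
    refine ⟨hst, ?_, ?_, ?_⟩
    · filter_upwards [hN.ae_jumpTime_ne_top] with ω hω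
      exact epsTime_le_jumpTime q P N (n + 1) ε φ (hN.isCountingPath ω) hω
    · obtain ⟨C, hC⟩ := exists_integrable_runCost_bound hq hN (n + 1) hφ
      exact (integrable_congr (hmin (n + 1) ε φ)).2 (hC _ (hmeas _ hst)).1
    · rw [integral_congr_ae (hmin (n + 1) ε φ), iterate_eq_value hq hN (n + 1) φ hφ]
      exact integral_runCost_epsTime_le hq hN n hε hφ
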